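/- Let $f=(f_1,\dots,f_m)\colon \mathbb{C}^n\to\mathbb{C}^m$ be a polynomial map of degree $d=\max_i \deg f_i$, and let $Y=\overline{f(\mathbb{C}^n)}$ be the Zariski closure of its image. Assume that $f$ is generically finite, i.e. the fibre $f^{-1}(y)$ is finite for all $y$ in some nonempty Zariski open subset of $Y$. Say that $f$ is proper at $y\in Y$ if $y$ has an affine Zariski open neighbourhood $U\subset Y$ such that $f^{-1}(U)$ is affine and $f|_{f^{-1}(U)}\colon f^{-1}(U)\to U$ is finite, i.e. the ring $\mathbb{C}[f^{-1}(U)]$ of regular functions is integral over $\mathbb{C}[U]$ via $h\mapsto h\circ f$; and let $S_f\subset Y$ be the set of points of $Y$ at which $f$ is not proper. Then $S_f$ is either empty, or it is an affine variety (a Zariski closed subset of $\mathbb{C}^m$, possibly reducible) with degree of $\mathbb{C}$-uniruledness at most $d-1$: for every irreducible component $Z$ of $S_f$ and every point $z\in Z$ there is a parametric curve of degree at most $d-1$ that passes through $z$ and is contained in $Z$. Here a parametric curve of degree at most $e$ is the image of a nonconstant polynomial map $\mathbb{C}\to\mathbb{C}^m$ all of whose components have degree at most $e$. -/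

import Mathlib

open MvPolynomial

/-- The common zero set in `ℂⁿ` of a set of polynomials. -/
def zeroSet {n : ℕ} (s : Set (MvPolynomial (Fin n) ℂ)) : Set (Fin n → ℂ) :=
  {x | ∀ p ∈ s, eval x p = 0}

/-- The Zariski topology on `ℂⁿ`: the closed sets are the common zero sets of polynomials.
It is not registered as an instance, since `Fin n → ℂ` carries the classical topology. -/
@[reducible]
def zariski (n : ℕ) : TopologicalSpace (Fin n → ℂ) :=
  TopologicalSpace.ofClosed {Z | ∃ s, Z = zeroSet s}
    ⟨{1}, by ext x; simp [zeroSet]⟩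
    (by
      intro A hA
      refine ⟨⋃₀ {s | zeroSet s ∈ A}, ?_⟩
      ext x
      constructor
      · rintro hx p ⟨s, hs, hp⟩
        exact hx _ hs p hp
      · intro hx Z hZ
        obtain ⟨s, rfl⟩ := hA hZ
        exact fun p hp => hx p ⟨s, hZ, hp⟩)
    (by
      rintro _ ⟨s, rfl⟩ _ ⟨t, rfl⟩
      refine ⟨{r | ∃ p ∈ s, ∃ q ∈ t, r = p * q}, ?_⟩
      ext x
      constructor
      · rintro (hx | hx) _ ⟨p, hp, q, hq, rfl⟩
        · simp [hx p hp]
        · simp [hx q hq]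
      · intro hx
        by_contra hcon
        simp only [Set.mem_union, zeroSet, Set.mem_ofPred_eq, not_or, not_forall] at hcon
        obtain ⟨⟨p, hp, hp0⟩, q, hq, hq0⟩ := hcon
        have := hx _ ⟨p, hp, q, hq, rfl⟩
        rw [map_mul] at this
        exact (mul_ne_zero hp0 hq0) this)

/-- The polynomial map `ℂⁿ → ℂᵐ` with components `f₁, …, fₘ`. -/
noncomputable def polyMap {n m : ℕ} (f : Fin m → MvPolynomial (Fin n) ℂ) :
    (Fin n → ℂ) → (Fin m → ℂ) :=
  fun x i => eval x (f i)

/-- The degree of a polynomial map: the maximum of the total degrees of its components. -/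
noncomputable def polyMapDegree {n m : ℕ} (f : Fin m → MvPolynomial (Fin n) ℂ) : ℕ :=
  Finset.univ.sup fun i => (f i).totalDegree

/-- The Zariski closure of the image of a polynomial map. -/
noncomputable def imageClosure {n m : ℕ} (f : Fin m → MvPolynomial (Fin n) ℂ) :
    Set (Fin m → ℂ) :=
  @closure _ (zariski m) (Set.range (polyMap f))

/-- `f` is generically finite: the fibres over a nonempty Zariski open subset of the
closure of the image are finite. (That closure is irreducible.) -/
def GenericallyFinite {n m : ℕ} (f : Fin m → MvPolynomial (Fin n) ℂ) : Prop :=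
  ∃ O : Set (Fin m → ℂ), @IsOpen _ (zariski m) O ∧ (imageClosure f ∩ O).Nonempty ∧
    ∀ y ∈ imageClosure f ∩ O, (polyMap f ⁻¹' {y}).Finite

/-- A function on a (locally closed) subset `V` of `ℂⁿ` is regular if, Zariski locally on `V`,
it is a quotient of two polynomials. -/
def IsRegularFun {n : ℕ} (V : Set (Fin n → ℂ)) (h : V → ℂ) : Prop :=
  ∀ x : V, ∃ p q : MvPolynomial (Fin n) ℂ, eval (x : Fin n → ℂ) q ≠ 0 ∧
    ∀ z : V, eval (z : Fin n → ℂ) q ≠ 0 →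
      h z = eval (z : Fin n → ℂ) p / eval (z : Fin n → ℂ) q

/-- The algebra `ℂ[V]` of regular functions on `V`. -/
def regularFunctions {n : ℕ} (V : Set (Fin n → ℂ)) : Subalgebra ℂ (V → ℂ) where
  carrier := {h | IsRegularFun V h}
  mul_mem' := by
    intro a b ha hb x
    obtain ⟨p, q, hq, h⟩ := ha x
    obtain ⟨p', q', hq', h'⟩ := hb x
    refine ⟨p * p', q * q', by simp [hq, hq'], fun z hz => ?_⟩
    rw [map_mul] at hz
    rw [Pi.mul_apply, h z (left_ne_zero_of_mul hz), h' z (right_ne_zero_of_mul hz), map_mul,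
      map_mul, div_mul_div_comm]
  add_mem' := by
    intro a b ha hb x
    obtain ⟨p, q, hq, h⟩ := ha x
    obtain ⟨p', q', hq', h'⟩ := hb x
    refine ⟨p * q' + q * p', q * q', by simp [hq, hq'], fun z hz => ?_⟩
    rw [map_mul] at hz
    rw [Pi.add_apply, h z (left_ne_zero_of_mul hz), h' z (right_ne_zero_of_mul hz), map_mul,
      map_add, map_mul, map_mul,
      div_add_div _ _ (left_ne_zero_of_mul hz) (right_ne_zero_of_mul hz)]
  algebraMap_mem' := by
    intro c x
    exact ⟨C c, 1, by simp, fun z _ => by simp⟩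

/-- The homomorphism `f^* : ℂ[U] → ℂ[f⁻¹(U)]`, `h ↦ h ∘ f`. -/
noncomputable def pullback {n m : ℕ} (f : Fin m → MvPolynomial (Fin n) ℂ)
    (U : Set (Fin m → ℂ)) :
    regularFunctions U →ₐ[ℂ] regularFunctions (polyMap f ⁻¹' U) where
  toFun h := ⟨fun z => h.1 ⟨polyMap f z.1, z.2⟩, by
    intro x
    obtain ⟨p, q, hq, H⟩ := h.2 ⟨polyMap f x.1, x.2⟩
    have key : ∀ (z : Fin n → ℂ) (r : MvPolynomial (Fin m) ℂ),
        eval z (bind₁ f r) = eval (polyMap f z) r := by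
      intro z r
      rw [← coe_aeval_eq_eval, AlgHom.coe_toRingHom, aeval_bind₁]
      simp only [aeval_eq_eval]; rfl
    refine ⟨bind₁ f p, bind₁ f q, by rw [key]; exact hq, fun z hz => ?_⟩
    rw [key] at hz ⊢
    rw [key]
    exact H ⟨polyMap f z.1, z.2⟩ hz⟩
  map_one' := rfl
  map_mul' _ _ := rfl
  map_zero' := rfl
  map_add' _ _ := rfl
  commutes' _ := rfl

/-- A (locally closed) subset `V` of `ℂⁿ` is affine if it is isomorphic, by regular maps, to a
Zariski closed subset of some affine space. -/
def IsAffineSet {n : ℕ} (V : Set (Fin n → ℂ)) : Prop :=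
  ∃ (N : ℕ) (W : Set (Fin N → ℂ)) (e : V ≃ W), @IsClosed _ (zariski N) W ∧
    (∀ i, IsRegularFun V fun v => (e v : Fin N → ℂ) i) ∧
    ∀ i, IsRegularFun W fun w => (e.symm w : Fin n → ℂ) i

/-- `f` is proper at a point `y` of the closure of its image: there is an affine Zariski open
neighbourhood `U` of `y` in the closure of the image, with affine preimage, such that
`f⁻¹(U) → U` is finite, i.e. `ℂ[f⁻¹(U)]` is integral over `ℂ[U]`. (The map `f⁻¹(U) → U` is
automatically dominant, as `U` is open in the closure of the image.) -/
def ProperAt {n m : ℕ} (f : Fin m → MvPolynomial (Fin n) ℂ) (y : Fin m → ℂ) : Prop :=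
  ∃ O : Set (Fin m → ℂ), @IsOpen _ (zariski m) O ∧ y ∈ O ∧
    IsAffineSet (imageClosure f ∩ O) ∧
    IsAffineSet (polyMap f ⁻¹' (imageClosure f ∩ O)) ∧
    (pullback f (imageClosure f ∩ O)).toRingHom.IsIntegral

/-- The non-properness set `S_f`: the points of the closure of the image at which `f` is not
proper. -/
def nonProperSet {n m : ℕ} (f : Fin m → MvPolynomial (Fin n) ℂ) : Set (Fin m → ℂ) :=
  {y | y ∈ imageClosure f ∧ ¬ ProperAt f y}

/-- A parametric curve of degree at most `d` in `ℂᵐ`: the image of a nonconstant polynomial map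
`ℂ → ℂᵐ` all of whose components have degree at most `d`. (Such an image is Zariski closed.) -/
def IsParametricCurve {m : ℕ} (d : ℕ) (Γ : Set (Fin m → ℂ)) : Prop :=
  ∃ p : Fin m → Polynomial ℂ, (∀ i, (p i).natDegree ≤ d) ∧ (∃ i, 0 < (p i).natDegree) ∧
    Γ = Set.range fun (t : ℂ) (i : Fin m) => (p i).eval t

/-- `Z` is an irreducible component of `X`: a maximal Zariski irreducible subset of `X`. -/
def IsIrredComponent {m : ℕ} (X Z : Set (Fin m → ℂ)) : Prop :=
  Maximal (fun s => s ⊆ X ∧ @IsIrreducible _ (zariski m) s) Z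

/-- `X` is an affine variety in `ℂᵐ` (a Zariski closed set, possibly reducible) with degree of
`ℂ`-uniruledness at most `d`: every point of every irreducible component `Z` of `X` lies on a
parametric curve of degree at most `d` contained in `Z`. -/
def UniruledDegreeAtMost {m : ℕ} (X : Set (Fin m → ℂ)) (d : ℕ) : Prop :=
  @IsClosed _ (zariski m) X ∧ ∀ Z, IsIrredComponent X Z → ∀ x ∈ Z,
    ∃ Γ, IsParametricCurve d Γ ∧ x ∈ Γ ∧ Γ ⊆ Z

/-!
The proof is algebraic: valuation rings replace sequences tending to infinity. Write `φ` for the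
comorphism `h ↦ h ∘ f` and `S` for the non-properness set.

*Properness and integrality.* `f` is proper at `y` in the closure of the image exactly when
`ℂ[x]` becomes integral over `ℂ[f]` after inverting some `h` with `h y ≠ 0`
(`properAt_of_integralAway`, `ProperAt.exists_integralAway`). Properness is an open condition by
definition, so `S` is closed. Generic finiteness makes the coordinates algebraic over `ℂ[f]`: a
transcendental coordinate would take infinitely many values on some general fibre
(`exists_infinite_fibre`). Hence `f` is proper at `f o` for some point `o`.

*A point at infinity.* Let `Z` be a component of `S`, with ideal `p`. Some coordinate `xᵢ` is not
integral over `ℂ[f]` localized at `p`, so a valuation ring `O` of an algebraic closure of `ℂ(x)`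
contains that localization but not `xᵢ`: the generic point of `ℂⁿ` is at infinity for `O`, while
its image under `f` specializes to a point of `S` (`zeroLocus_ker_residue_subset`).

*The curve.* Join `o` to the generic point `x` by the line `t ↦ o + (1 + t) (x - o)`. After a
dilation `t ↦ l t`, the image of this line has coefficients in `O` and a nonconstant reduction over
the residue field. If `l` were not infinitesimal, the image of the line itself would have
coefficients in `O`, and points of the line close to `o` in the parameter, but still at infinity,
would show that `f o ∈ S` (`line_not_integral`). So `l` is infinitesimal. The value `f o`, which is
finite, is then taken at the infinite parameter `-1 / l`, so the coefficient of degree `d` reduces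
to zero and the reduction has degree at most `d - 1` (`exists_reduced_line`). At each complex
parameter the line is still at infinity, so the reduced curve lies in `S`; it starts at a point
whose closure contains `Z`, and maximality of `Z` puts the whole curve in `Z` and its origin at the
generic point of `Z` (`exists_generic_curve`).

*Special points.* For an arbitrary `z ∈ Z`, the same dilation argument, with a valuation ring
centred at `z`, specializes this curve to one through `z` (`exists_parametricCurve_of_generic`), and
the Nullstellensatz makes it complex (`exists_parametricCurve_of_extension`).
-/

/-! ### The Zariski topology and vanishing ideals -/

theorem isClosed_zariski_iff {n : ℕ} {Z : Set (Fin n → ℂ)} :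
    @IsClosed _ (zariski n) Z ↔ ∃ s, Z = zeroSet s := by
  rw [← @isOpen_compl_iff _ _ (zariski n)]
  change Zᶜᶜ ∈ {Z | ∃ s, Z = zeroSet s} ↔ _
  rw [compl_compl]; rfl

theorem mem_vanishingIdeal_iff_eval {n : ℕ} {Z : Set (Fin n → ℂ)} {p : MvPolynomial (Fin n) ℂ} :
    p ∈ vanishingIdeal ℂ Z ↔ ∀ x ∈ Z, eval x p = 0 := Iff.rfl

theorem mem_zeroLocus_iff_eval {n : ℕ} {I : Ideal (MvPolynomial (Fin n) ℂ)} {x : Fin n → ℂ} :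
    x ∈ zeroLocus ℂ I ↔ ∀ p ∈ I, eval x p = 0 := Iff.rfl

theorem isClosed_zeroLocus {n : ℕ} (I : Ideal (MvPolynomial (Fin n) ℂ)) :
    @IsClosed _ (zariski n) (zeroLocus ℂ I) :=
  isClosed_zariski_iff.2 ⟨I, rfl⟩

theorem zeroLocus_vanishingIdeal_of_isClosed {n : ℕ} {Z : Set (Fin n → ℂ)}
    (hZ : @IsClosed _ (zariski n) Z) : zeroLocus ℂ (vanishingIdeal ℂ Z) = Z := by
  obtain ⟨s, rfl⟩ := isClosed_zariski_iff.1 hZ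
  refine Set.Subset.antisymm (fun x hx p hp => hx p fun y hy => hy p hp) ?_
  exact zeroLocus_vanishingIdeal_le _

/-- A polynomial separating a point from a Zariski closed set. -/
theorem exists_mem_vanishingIdeal_eval_ne_zero {n : ℕ} {Z : Set (Fin n → ℂ)}
    (hZ : @IsClosed _ (zariski n) Z) {y : Fin n → ℂ} (hy : y ∉ Z) :
    ∃ h ∈ vanishingIdeal ℂ Z, eval y h ≠ 0 := by
  rw [← zeroLocus_vanishingIdeal_of_isClosed hZ, mem_zeroLocus_iff_eval] at hy
  push Not at hy
  exact hy

theorem mem_closure_zariski_iff {n : ℕ} {S : Set (Fin n → ℂ)} {y : Fin n → ℂ} :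
    y ∈ @closure _ (zariski n) S ↔ ∀ h ∈ vanishingIdeal ℂ S, eval y h = 0 := by
  let := zariski n
  constructor
  · intro hy h hh
    exact closure_minimal (t := zeroLocus ℂ (vanishingIdeal ℂ S))
      (zeroLocus_vanishingIdeal_le _) (isClosed_zeroLocus _) hy h hh
  · intro hy
    by_contra hcon
    obtain ⟨h, hh, h0⟩ := exists_mem_vanishingIdeal_eval_ne_zero isClosed_closure hcon
    exact h0 (hy h fun x hx => hh x (subset_closure hx))

theorem isOpen_basicOpen {n : ℕ} (h : MvPolynomial (Fin n) ℂ) :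
    @IsOpen _ (zariski n) {y | eval y h ≠ 0} := by
  let := zariski n
  have : IsClosed (zeroSet {h}) := isClosed_zariski_iff.2 ⟨_, rfl⟩
  convert this.isOpen_compl using 1
  ext y; simp [zeroSet]

/-- The basic open sets form a basis of the Zariski topology. -/
theorem exists_basicOpen_subset {n : ℕ} {O : Set (Fin n → ℂ)} (hO : @IsOpen _ (zariski n) O)
    {y : Fin n → ℂ} (hy : y ∈ O) :
    ∃ h : MvPolynomial (Fin n) ℂ, eval y h ≠ 0 ∧ ∀ z, eval z h ≠ 0 → z ∈ O := by
  let := zariski n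
  obtain ⟨h, hh, h0⟩ := exists_mem_vanishingIdeal_eval_ne_zero (y := y) hO.isClosed_compl
    (by simpa using hy)
  refine ⟨h, h0, fun z hz => ?_⟩
  by_contra hcon
  exact hz (hh z hcon)

theorem isPrime_vanishingIdeal {n : ℕ} {Z : Set (Fin n → ℂ)}
    (hZ : @IsIrreducible _ (zariski n) Z) : (vanishingIdeal ℂ Z).IsPrime := by
  let := zariski n
  obtain ⟨z, hz⟩ := hZ.1
  refine ⟨fun h => ?_, fun {a b} hab => ?_⟩
  · have : (1 : MvPolynomial (Fin n) ℂ) ∈ vanishingIdeal ℂ Z := h ▸ Submodule.mem_top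
    simpa using this z hz
  · by_contra hcon
    rw [not_or, mem_vanishingIdeal_iff_eval, mem_vanishingIdeal_iff_eval] at hcon
    push Not at hcon
    obtain ⟨⟨x, hx, hxa⟩, y, hy, hyb⟩ := hcon
    obtain ⟨w, hw, hwa, hwb⟩ := hZ.2 _ _ (isOpen_basicOpen a) (isOpen_basicOpen b)
      ⟨x, hx, hxa⟩ ⟨y, hy, hyb⟩
    have := hab w hw
    rw [map_mul] at this
    exact mul_ne_zero hwa hwb this

theorem isIrreducible_zeroLocus {n : ℕ} (P : Ideal (MvPolynomial (Fin n) ℂ)) [hP : P.IsPrime] :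
    @IsIrreducible _ (zariski n) (zeroLocus ℂ P) := by
  let := zariski n
  have key : ∀ p, (∀ x ∈ zeroLocus ℂ P, eval x p = 0) → p ∈ P := fun p hp => by
    rw [← IsPrime.vanishingIdeal_zeroLocus (K := ℂ) P]
    exact hp
  constructor
  · by_contra hcon
    rw [Set.not_nonempty_iff_eq_empty] at hcon
    exact hP.one_notMem (key 1 fun x hx => by simp [hcon] at hx)
  · rintro u v hu hv ⟨x, hx, hxu⟩ ⟨y, hy, hyv⟩
    obtain ⟨a, ha, hau⟩ := exists_basicOpen_subset hu hxu
    obtain ⟨b, hb, hbv⟩ := exists_basicOpen_subset hv hyv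
    by_contra hcon
    have hab : a * b ∈ P := key _ fun z hz => by
      by_contra h0
      rw [map_mul] at h0
      exact hcon ⟨z, hz, hau z (left_ne_zero_of_mul h0), hbv z (right_ne_zero_of_mul h0)⟩
    rcases hP.mem_or_mem hab with h | h
    · exact ha (hx a h)
    · exact hb (hy b h)

/-! ### The comorphism of a polynomial map -/

/-- The ring homomorphism `ℂ[y₁, …, yₘ] → ℂ[x₁, …, xₙ]`, `h ↦ h ∘ f`. -/
noncomputable abbrev comorphism {n m : ℕ} (f : Fin m → MvPolynomial (Fin n) ℂ) :
    MvPolynomial (Fin m) ℂ →+* MvPolynomial (Fin n) ℂ :=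
  (bind₁ f).toRingHom

theorem eval_comorphism {n m : ℕ} (f : Fin m → MvPolynomial (Fin n) ℂ) (x : Fin n → ℂ)
    (h : MvPolynomial (Fin m) ℂ) : eval x (comorphism f h) = eval (polyMap f x) h := by
  change eval x (bind₁ f h) = _
  rw [← coe_aeval_eq_eval, AlgHom.coe_toRingHom, aeval_bind₁]
  simp only [aeval_eq_eval]; rfl

theorem comorphism_eq_zero_iff {n m : ℕ} {f : Fin m → MvPolynomial (Fin n) ℂ}
    {h : MvPolynomial (Fin m) ℂ} :
    comorphism f h = 0 ↔ h ∈ vanishingIdeal ℂ (Set.range (polyMap f)) := by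
  rw [mem_vanishingIdeal_iff_eval, Set.forall_mem_range]
  constructor
  · intro h0 x
    rw [← eval_comorphism, h0, map_zero]
  · intro h0
    refine MvPolynomial.funext fun x => ?_
    rw [eval_comorphism, h0, map_zero]

theorem mem_imageClosure_iff {n m : ℕ} {f : Fin m → MvPolynomial (Fin n) ℂ} {y : Fin m → ℂ} :
    y ∈ imageClosure f ↔ ∀ h, comorphism f h = 0 → eval y h = 0 := by
  rw [imageClosure, mem_closure_zariski_iff]
  simp only [comorphism_eq_zero_iff]

theorem isClosed_imageClosure {n m : ℕ} (f : Fin m → MvPolynomial (Fin n) ℂ) :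
    @IsClosed _ (zariski m) (imageClosure f) :=
  let := zariski m; isClosed_closure

theorem polyMap_mem_imageClosure {n m : ℕ} (f : Fin m → MvPolynomial (Fin n) ℂ) (x : Fin n → ℂ) :
    polyMap f x ∈ imageClosure f :=
  let := zariski m; subset_closure ⟨x, rfl⟩

theorem isClosed_nonProperSet {n m : ℕ} (f : Fin m → MvPolynomial (Fin n) ℂ) :
    @IsClosed _ (zariski m) (nonProperSet f) := by
  let := zariski m
  have : nonProperSet f = imageClosure f ∩ {y | ProperAt f y}ᶜ := rfl
  rw [this]
  refine (isClosed_imageClosure f).inter (isOpen_iff_forall_mem_open.2 ?_).isClosed_compl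
  rintro y ⟨O, hO, hy, h⟩
  exact ⟨O, fun z hz => ⟨O, hO, hz, h⟩, hO, hy⟩

/-! ### Integrality away from a hypersurface -/

/-- `S` becomes integral over `R` after inverting `h`, expressed without localizations: every
element of `S` has an integral multiple by some power of `φ h`. -/
def IntegralAway {R S : Type*} [CommRing R] [CommRing S] (φ : R →+* S) (h : R) : Prop :=
  ∀ b, ∃ N, φ.IsIntegralElem (φ h ^ N * b)

theorem RingHom.IsIntegralElem.pow_mul_of_le {R S : Type*} [CommRing R] [CommRing S] {φ : R →+* S}
    {h : R} {b : S} {N M : ℕ} (hb : φ.IsIntegralElem (φ h ^ N * b)) (hNM : N ≤ M) :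
    φ.IsIntegralElem (φ h ^ M * b) := by
  obtain ⟨k, rfl⟩ := Nat.exists_eq_add_of_le hNM
  have := (φ.isIntegralElem_map (x := h ^ k)).mul φ hb
  rwa [map_pow, ← mul_assoc, ← pow_add, add_comm k] at this

/-- It suffices to check integrality on the coordinates. -/
theorem integralAway_of_forall_X {n : ℕ} {R : Type*} [CommRing R]
    {φ : R →+* MvPolynomial (Fin n) ℂ} {h : R} (hC : ∀ c, φ.IsIntegralElem (C c))
    (hX : ∀ i, ∃ N, φ.IsIntegralElem (φ h ^ N * X i)) : IntegralAway φ h := by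
  intro b
  induction b using MvPolynomial.induction_on with
  | C c => exact ⟨0, by simpa using hC c⟩
  | add p q hp hq =>
    obtain ⟨N, hN⟩ := hp
    obtain ⟨M, hM⟩ := hq
    refine ⟨max N M, ?_⟩
    rw [mul_add]
    exact (hN.pow_mul_of_le (le_max_left _ _)).add φ (hM.pow_mul_of_le (le_max_right _ _))
  | mul_X p i hp =>
    obtain ⟨N, hN⟩ := hp
    obtain ⟨M, hM⟩ := hX i
    refine ⟨N + M, ?_⟩
    rw [pow_add, mul_mul_mul_comm]
    exact hN.mul φ hM

theorem isIntegralElem_comorphism_C {n m : ℕ} (f : Fin m → MvPolynomial (Fin n) ℂ) (c : ℂ) :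
    (comorphism f).IsIntegralElem (C c) := by
  have : (C c : MvPolynomial (Fin n) ℂ) = comorphism f (C c) := (algHom_C (bind₁ f) c).symm
  rw [this]
  exact RingHom.isIntegralElem_map _

/-- Coordinatewise integrality with different denominators yields a common denominator. -/
theorem integralAway_prod {n m : ℕ} {f : Fin m → MvPolynomial (Fin n) ℂ}
    {h : Fin n → MvPolynomial (Fin m) ℂ}
    (hX : ∀ i, ∃ N, (comorphism f).IsIntegralElem (comorphism f (h i) ^ N * X i)) :
    IntegralAway (comorphism f) (∏ i, h i) := by
  refine integralAway_of_forall_X (isIntegralElem_comorphism_C f) fun i => ?_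
  obtain ⟨N, hN⟩ := hX i
  refine ⟨N, ?_⟩
  rw [← Finset.mul_prod_erase _ _ (Finset.mem_univ i), map_mul, mul_pow, mul_comm (_ ^ N) (_ ^ N),
    mul_assoc, ← map_pow]
  exact (RingHom.isIntegralElem_map _).mul _ hN

/-! ### Regular functions on basic open sets -/

/-- The restriction of polynomials to regular functions. -/
noncomputable def restrictPoly {n : ℕ} (V : Set (Fin n → ℂ)) :
    MvPolynomial (Fin n) ℂ →+* regularFunctions V where
  toFun p := ⟨fun z => eval (z : Fin n → ℂ) p, fun x => ⟨p, 1, by simp, fun z _ => by simp⟩⟩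
  map_one' := Subtype.ext <| funext fun z => by simp
  map_mul' p q := Subtype.ext <| funext fun z => by simp
  map_zero' := Subtype.ext <| funext fun z => by simp
  map_add' p q := Subtype.ext <| funext fun z => by simp

theorem restrictPoly_apply {n : ℕ} {V : Set (Fin n → ℂ)} (p : MvPolynomial (Fin n) ℂ) (z : V) :
    (restrictPoly V p : V → ℂ) z = eval (z : Fin n → ℂ) p := rfl

theorem pullback_comp_restrictPoly {n m : ℕ} (f : Fin m → MvPolynomial (Fin n) ℂ)
    (U : Set (Fin m → ℂ)) :
    (pullback f U).toRingHom.comp (restrictPoly U) =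
      (restrictPoly (polyMap f ⁻¹' U)).comp (comorphism f) := by
  refine RingHom.ext fun h => Subtype.ext <| funext fun z => ?_
  exact (eval_comorphism f z h).symm

/-- A local representation of a regular function gives a denominator valid on all of `V`. -/
theorem IsRegularFun.exists_denominator {n : ℕ} {V : Set (Fin n → ℂ)} {k : V → ℂ}
    (hk : IsRegularFun V k) (x : V) : ∃ q p : MvPolynomial (Fin n) ℂ, eval (x : Fin n → ℂ) q ≠ 0 ∧
      ∀ z : V, eval (z : Fin n → ℂ) q * k z = eval (z : Fin n → ℂ) p := by
  obtain ⟨p, q, hq, h⟩ := hk x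
  refine ⟨q * q, q * p, by simpa using hq, fun z => ?_⟩
  by_cases hz : eval (z : Fin n → ℂ) q = 0
  · simp [hz]
  · rw [h z hz, map_mul, map_mul]
    field_simp

/-- The regular functions on a basic open subset `g ≠ 0` of `ℂⁿ` are the quotients `p / gᴺ`. -/
theorem IsRegularFun.exists_pow_mul_eq {n : ℕ} {V : Set (Fin n → ℂ)} {g : MvPolynomial (Fin n) ℂ}
    (hV : ∀ x, x ∈ V ↔ eval x g ≠ 0) {k : V → ℂ} (hk : IsRegularFun V k) :
    ∃ (N : ℕ) (p : MvPolynomial (Fin n) ℂ), ∀ z : V,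
      eval (z : Fin n → ℂ) g ^ N * k z = eval (z : Fin n → ℂ) p := by
  -- The denominators of `k` form an ideal whose zeros are zeros of `g`.
  let J : Ideal (MvPolynomial (Fin n) ℂ) :=
    { carrier := {q | ∃ p, ∀ z : V, eval (z : Fin n → ℂ) q * k z = eval (z : Fin n → ℂ) p}
      zero_mem' := ⟨0, by simp⟩
      add_mem' := by
        rintro a b ⟨p, hp⟩ ⟨q, hq⟩
        exact ⟨p + q, fun z => by rw [map_add, map_add, add_mul, hp, hq]⟩
      smul_mem' := by
        rintro c a ⟨p, hp⟩
        exact ⟨c * p, fun z => by rw [smul_eq_mul, map_mul, map_mul, mul_assoc, hp]⟩ }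
  have hg : g ∈ vanishingIdeal ℂ (zeroLocus ℂ J) := by
    intro x hx
    by_contra h0
    obtain ⟨q, p, hq, hp⟩ := hk.exists_denominator ⟨x, (hV x).2 h0⟩
    exact hq (hx q ⟨p, hp⟩)
  rw [vanishingIdeal_zeroLocus_eq_radical] at hg
  obtain ⟨N, p, hp⟩ := hg
  exact ⟨N, p, fun z => by rw [← hp z, map_pow]⟩

/-- A basic open subset of a closed set is affine, by the map `v ↦ (v, 1 / h v)`. -/
theorem isAffineSet_inter_basicOpen {n : ℕ} {V : Set (Fin n → ℂ)}
    (hV : @IsClosed _ (zariski n) V) (h : MvPolynomial (Fin n) ℂ) :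
    IsAffineSet (V ∩ {y | eval y h ≠ 0}) := by
  have hren : ∀ (w : Fin (n + 1) → ℂ) (p : MvPolynomial (Fin n) ℂ),
      eval w (rename Fin.castSucc p) = eval (Fin.init w) p := fun w p => by
    rw [eval_rename]; rfl
  refine ⟨n + 1, {w | Fin.init w ∈ V ∧ w (Fin.last n) * eval (Fin.init w) h = 1},
    { toFun := fun v => ⟨Fin.snoc v.1 (eval v.1 h)⁻¹, ?_⟩
      invFun := fun w => ⟨Fin.init w.1, w.2.1, right_ne_zero_of_mul_eq_one w.2.2⟩
      left_inv := fun v => ?_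
      right_inv := fun w => ?_ }, ?_, ?_, ?_⟩
  · simp only [Set.mem_ofPred_eq, Fin.init_snoc, Fin.snoc_last]
    exact ⟨v.2.1, inv_mul_cancel₀ v.2.2⟩
  · simp
  · refine Subtype.ext ?_
    simp only
    rw [← eq_inv_of_mul_eq_one_left w.2.2, Fin.snoc_init_self]
  · refine isClosed_zariski_iff.2 ⟨(rename Fin.castSucc '' (vanishingIdeal ℂ V : Set _)) ∪
      {X (Fin.last n) * rename Fin.castSucc h - 1}, ?_⟩
    ext w
    have hw : Fin.init w ∈ V ↔ ∀ p ∈ vanishingIdeal ℂ V, eval (Fin.init w) p = 0 := by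
      conv_lhs => rw [← zeroLocus_vanishingIdeal_of_isClosed hV]
      rfl
    simp only [zeroSet, Set.mem_ofPred_eq, hw, Set.mem_union, Set.mem_image, SetLike.mem_coe,
      Set.mem_singleton_iff]
    constructor
    · rintro ⟨h1, h2⟩ p (⟨p, hp, rfl⟩ | rfl)
      · rw [hren, h1 p hp]
      · simp [hren, h2]
    · intro H
      refine ⟨fun p hp => ?_, ?_⟩
      · rw [← hren]
        exact H _ (Or.inl ⟨p, hp, rfl⟩)
      · have := H _ (Or.inr rfl)
        simpa [hren, sub_eq_zero] using this
  · intro i x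
    induction i using Fin.lastCases with
    | last => exact ⟨1, h, x.2.2, fun z _ => by simp⟩
    | cast i => exact ⟨X i, 1, by simp, fun z _ => by simp⟩
  · intro i x
    exact ⟨X i.castSucc, 1, by simp, fun z _ => by simp [Fin.init]⟩

/-! ### Properness and integrality -/

theorem properAt_of_integralAway {n m : ℕ} {f : Fin m → MvPolynomial (Fin n) ℂ}
    {h : MvPolynomial (Fin m) ℂ} (hh : IntegralAway (comorphism f) h) {y : Fin m → ℂ}
    (hy : eval y h ≠ 0) : ProperAt f y := by
  set O : Set (Fin m → ℂ) := {y | eval y h ≠ 0} with hO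
  have hpre : ∀ x, x ∈ polyMap f ⁻¹' (imageClosure f ∩ O) ↔ eval x (comorphism f h) ≠ 0 :=
    fun x => by
      rw [eval_comorphism]
      exact ⟨fun hx => hx.2, fun hx => ⟨polyMap_mem_imageClosure f x, hx⟩⟩
  refine ⟨O, isOpen_basicOpen h, hy, isAffineSet_inter_basicOpen (isClosed_imageClosure f) h,
    ?_, ?_⟩
  · have : polyMap f ⁻¹' (imageClosure f ∩ O) =
        Set.univ ∩ {x | eval x (comorphism f h) ≠ 0} := by
      ext x; rw [hpre]; simp
    rw [this]
    exact isAffineSet_inter_basicOpen (@isClosed_univ _ (zariski n)) _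
  · intro k
    obtain ⟨N, p, hp⟩ := IsRegularFun.exists_pow_mul_eq hpre k.2
    obtain ⟨M, hM⟩ := hh p
    have h1 := hM.map (restrictPoly (polyMap f ⁻¹' (imageClosure f ∩ O)))
    rw [← pullback_comp_restrictPoly] at h1
    have h2 := h1.of_comp
    let u : regularFunctions (imageClosure f ∩ O) :=
      ⟨fun z => (eval z.1 h)⁻¹, fun x => ⟨1, h, x.2.2, fun z _ => by simp⟩⟩
    refine RingHom.IsIntegralElem.of_mul_unit _ k
      ((pullback f _).toRingHom (restrictPoly _ h) ^ (M + N)) (u ^ (M + N)) ?_ ?_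
    · rw [map_pow, ← mul_pow, ← map_mul]
      have : u * restrictPoly _ h = 1 :=
        Subtype.ext <| funext fun z => inv_mul_cancel₀ z.2.2
      rw [this, map_one, one_pow]
    · suffices h3 : k * (pullback f _).toRingHom (restrictPoly _ h) ^ (M + N) =
          restrictPoly (polyMap f ⁻¹' (imageClosure f ∩ O)) (comorphism f h ^ M * p) by rwa [h3]
      refine Subtype.ext <| funext fun z => ?_
      have hz : ((pullback f (imageClosure f ∩ O)).toRingHom (restrictPoly _ h) : _ → ℂ) z =
          eval z.1 (comorphism f h) := (eval_comorphism f z h).symm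
      have e1 : (((k * (pullback f (imageClosure f ∩ O)).toRingHom (restrictPoly _ h) ^ (M + N) :
          regularFunctions _)) : _ → ℂ) z = k.1 z * (eval z.1 (comorphism f h)) ^ (M + N) := by
        rw [← hz]; rfl
      rw [e1, restrictPoly_apply, map_mul, map_pow, ← hp z]
      ring

/-- Finitely many regular functions have a common denominator near a given point. -/
theorem exists_common_denominator {n : ℕ} {V : Set (Fin n → ℂ)} (a : ℕ → regularFunctions V)
    (x : V) (s : Finset ℕ) : ∃ q : MvPolynomial (Fin n) ℂ, eval (x : Fin n → ℂ) q ≠ 0 ∧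
      ∀ k ∈ s, ∃ p : MvPolynomial (Fin n) ℂ, ∀ z : V,
        eval (z : Fin n → ℂ) q * (a k : V → ℂ) z = eval (z : Fin n → ℂ) p := by
  classical
  choose q p hq hp using fun k => (a k).2.exists_denominator x
  refine ⟨∏ k ∈ s, q k, ?_, fun k hk => ⟨(∏ j ∈ s.erase k, q j) * p k, fun z => ?_⟩⟩
  · rw [map_prod]
    exact Finset.prod_ne_zero_iff.2 fun k _ => hq k
  · rw [← Finset.prod_erase_mul _ _ hk, map_mul, map_mul, mul_assoc, hp]

/-- At a point of properness, each coordinate satisfies an integral equation after inverting one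
polynomial which does not vanish at the point. -/
theorem ProperAt.exists_isIntegralElem_X {n m : ℕ} {f : Fin m → MvPolynomial (Fin n) ℂ}
    {y : Fin m → ℂ} (hy : y ∈ imageClosure f) (hp : ProperAt f y) (i : Fin n) :
    ∃ h : MvPolynomial (Fin m) ℂ, eval y h ≠ 0 ∧
      (comorphism f).IsIntegralElem (comorphism f h * X i) := by
  obtain ⟨O, hO, hyO, -, -, hint⟩ := hp
  obtain ⟨h₀, h₀y, h₀O⟩ := exists_basicOpen_subset hO hyO
  obtain ⟨P, hP, hroot⟩ := hint (restrictPoly _ (X i))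
  set d := P.natDegree with hd
  obtain ⟨q, hqy, hq⟩ := exists_common_denominator P.coeff ⟨y, hy, hyO⟩ (Finset.range d)
  have hc : ∀ k, ∃ p : MvPolynomial (Fin m) ℂ, k ∈ Finset.range d →
      ∀ z : (imageClosure f ∩ O : Set _),
        eval z.1 q * (P.coeff k : _ → ℂ) z = eval z.1 p := fun k => by
    by_cases hk : k ∈ Finset.range d
    · obtain ⟨p, hp⟩ := hq k hk
      exact ⟨p, fun _ => hp⟩
    · exact ⟨0, fun h => absurd h hk⟩
  choose p hp using hc
  set h := h₀ * q with hh
  clear_value h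
  have hyh : eval y h ≠ 0 := by rw [hh, map_mul]; exact mul_ne_zero h₀y hqy
  have hφh : comorphism f h ≠ 0 := fun h0 => hyh (mem_imageClosure_iff.1 hy h h0)
  refine ⟨h, hyh, Polynomial.X ^ d +
    ∑ k ∈ Finset.range d, Polynomial.C (h ^ (d - 1 - k) * (h₀ * p k)) * Polynomial.X ^ k, ?_, ?_⟩
  · refine Polynomial.monic_X_pow_add ?_
    refine (Polynomial.degree_sum_le _ _).trans_lt ((Finset.sup_lt_iff (WithBot.bot_lt_coe d)).2 ?_)
    intro k hk
    exact (Polynomial.degree_C_mul_X_pow_le _ _).trans_lt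
      (Nat.cast_lt.2 (Finset.mem_range.1 hk))
  · -- Both sides agree where `h ∘ f` does not vanish.
    refine (mul_eq_zero.1 (?_ : comorphism f h * _ = 0)).resolve_left hφh
    refine MvPolynomial.funext fun x => ?_
    rw [map_mul, map_zero, eval_comorphism, mul_eq_zero, or_iff_not_imp_left]
    intro hx
    have hx₀ : eval (polyMap f x) h₀ ≠ 0 := by
      rw [hh, map_mul] at hx; exact left_ne_zero_of_mul hx
    let z : (imageClosure f ∩ O : Set _) := ⟨polyMap f x, polyMap_mem_imageClosure f x, h₀O _ hx₀⟩
    have hr : ∑ k ∈ Finset.range (d + 1), (P.coeff k : _ → ℂ) z * x i ^ k = 0 := by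
      rw [Polynomial.eval₂_eq_sum_range] at hroot
      let ev : regularFunctions (polyMap f ⁻¹' (imageClosure f ∩ O)) →+* ℂ :=
        (Pi.evalRingHom (fun _ => ℂ) (⟨x, z.2⟩ : polyMap f ⁻¹' (imageClosure f ∩ O))).comp
          (regularFunctions _).subtype
      have := congrArg ev hroot
      rw [map_sum, map_zero] at this
      rw [← this]
      refine Finset.sum_congr rfl fun k _ => ?_
      rw [map_mul, map_pow]
      congr 2
      exact (eval_X (f := x) i).symm
    rw [Finset.sum_range_succ, hd, hP.coeff_natDegree, ← hd] at hr
    have hone : ((1 : regularFunctions (imageClosure f ∩ O)) : _ → ℂ) z = 1 := rfl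
    rw [hone, one_mul] at hr
    rw [Polynomial.eval₂_add, Polynomial.eval₂_pow, Polynomial.eval₂_X, Polynomial.eval₂_finsetSum,
      map_add, map_sum, map_pow, map_mul, eval_comorphism, eval_X, mul_pow,
      eq_neg_of_add_eq_zero_right hr, mul_neg, Finset.mul_sum, neg_add_eq_zero]
    refine Finset.sum_congr rfl fun k hk => ?_
    have hk' := Finset.mem_range.1 hk
    have e1 : eval x (comorphism f (h ^ (d - 1 - k) * (h₀ * p k))) = eval (polyMap f x) h ^
        (d - 1 - k) * (eval (polyMap f x) h₀ * (eval z.1 q * (P.coeff k : _ → ℂ) z)) := by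
      rw [eval_comorphism, map_mul, map_mul, map_pow, ← hp k hk z]
    rw [Polynomial.eval₂_mul, Polynomial.eval₂_C, Polynomial.eval₂_pow, Polynomial.eval₂_X,
      map_mul, e1, map_pow, map_mul, eval_comorphism, eval_X, mul_pow]
    have hsplit : eval (polyMap f x) h ^ d =
        eval (polyMap f x) h ^ (d - 1 - k) * eval (polyMap f x) h * eval (polyMap f x) h ^ k := by
      rw [← pow_succ, ← pow_add]; congr 1; omega
    rw [hsplit]
    have hval : eval (polyMap f x) h = eval (polyMap f x) h₀ * eval z.1 q := by
      rw [hh, map_mul]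
    rw [hval]
    ring

theorem ProperAt.exists_integralAway {n m : ℕ} {f : Fin m → MvPolynomial (Fin n) ℂ}
    {y : Fin m → ℂ} (hy : y ∈ imageClosure f) (hp : ProperAt f y) :
    ∃ h : MvPolynomial (Fin m) ℂ, eval y h ≠ 0 ∧ IntegralAway (comorphism f) h := by
  choose h hh hint using hp.exists_isIntegralElem_X hy
  refine ⟨∏ i, h i, ?_, integralAway_prod fun i => ⟨1, by simpa using hint i⟩⟩
  rw [map_prod]
  exact Finset.prod_ne_zero_iff.2 fun i _ => hh i

/-! ### Generic finiteness -/

/-- Lying over for an extension that is integral after inverting `g`: a prime avoiding `g`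
generates a proper ideal. -/
theorem Ideal.map_ne_top_of_isIntegral_pow_smul {A B : Type*} [CommRing A] [CommRing B]
    [Algebra A B] (hinj : Function.Injective (algebraMap A B)) {g : A}
    (hint : ∀ b : B, ∃ N, IsIntegral A (g ^ N • b)) (P : Ideal A) [hP : P.IsPrime] (hg : g ∉ P) :
    P.map (algebraMap A B) ≠ ⊤ := by
  have hker : (⊥ : Ideal (integralClosure A B)).comap (algebraMap A (integralClosure A B)) ≤ P := by
    intro a ha
    have h0 : algebraMap A (integralClosure A B) a = 0 := ha
    have : algebraMap A B a = 0 := congrArg Subtype.val h0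
    rw [(injective_iff_map_eq_zero _).1 hinj a this]
    exact P.zero_mem
  obtain ⟨Q, -, hQ, hQP⟩ := Ideal.exists_ideal_over_prime_of_isIntegral P ⊥ hker
  have key : ∀ b ∈ P.map (algebraMap A B), ∃ N, ∃ q ∈ Q, (q : B) = g ^ N • b := by
    intro b hb
    induction hb using Submodule.span_induction with
    | mem b hb =>
      obtain ⟨a, ha, rfl⟩ := hb
      refine ⟨0, algebraMap A _ a, ?_, by simp⟩
      rw [← Ideal.mem_comap, hQP]
      exact ha
    | zero => exact ⟨0, 0, Q.zero_mem, by simp⟩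
    | add b c _ _ hb hc =>
      obtain ⟨N, q, hq, hqb⟩ := hb
      obtain ⟨M, r, hr, hrc⟩ := hc
      refine ⟨N + M, g ^ M • q + g ^ N • r, Q.add_mem (Q.smul_of_tower_mem _ hq)
        (Q.smul_of_tower_mem _ hr), ?_⟩
      simp only [Subalgebra.coe_add, Subalgebra.coe_smul, hqb, hrc, smul_add, smul_smul, pow_add,
        mul_comm]
    | smul c b _ hb =>
      obtain ⟨N, q, hq, hqb⟩ := hb
      obtain ⟨M, hM⟩ := hint c
      refine ⟨M + N, ⟨_, hM⟩ * q, Q.mul_mem_left _ hq, ?_⟩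
      simp only [Subalgebra.coe_mul, hqb, smul_eq_mul, pow_add, Algebra.smul_def, map_mul]
      ring
  intro htop
  obtain ⟨N, q, hq, hq1⟩ := key 1 (htop ▸ Submodule.mem_top)
  have : algebraMap A (integralClosure A B) (g ^ N) = q := by
    refine Subtype.ext ?_
    rw [hq1, Algebra.smul_def, mul_one]; rfl
  rw [← this, ← Ideal.mem_comap, hQP] at hq
  exact hg (hP.mem_of_pow_mem N hq)

theorem RingHom.isIntegralElem_of_isIntegral_range {R S : Type*} [CommRing R] [CommRing S]
    {φ : R →+* S} {x : S} (hx : _root_.IsIntegral φ.range x) : φ.IsIntegralElem x := by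
  obtain ⟨p, hp, hpx⟩ := hx
  obtain ⟨q, rfl, -, hq⟩ := Polynomial.lifts_and_natDegree_eq_and_monic
    ((Polynomial.mem_lifts p).2 (Polynomial.map_surjective _ φ.rangeRestrict_surjective p)) hp
  refine ⟨q, hq, ?_⟩
  rw [Polynomial.eval₂_map] at hpx
  exact hpx

/-- Algebraicity of the coordinates over `ℂ[f₁, …, fₘ]` gives integrality over a dense open set. -/
theorem exists_integralAway_of_isAlgebraic {n m : ℕ} {f : Fin m → MvPolynomial (Fin n) ℂ}
    (halg : Algebra.IsAlgebraic (comorphism f).range (MvPolynomial (Fin n) ℂ)) :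
    ∃ h : MvPolynomial (Fin m) ℂ, comorphism f h ≠ 0 ∧ IntegralAway (comorphism f) h := by
  classical
  obtain ⟨⟨_, h, rfl⟩, hy, hint⟩ := Algebra.IsAlgebraic.exists_integral_multiples
    (comorphism f).range (Finset.univ.image (X : Fin n → MvPolynomial (Fin n) ℂ))
  refine ⟨h, fun h0 => hy (Subtype.ext h0), ?_⟩
  refine integralAway_of_forall_X (isIntegralElem_comorphism_C f) fun i => ⟨1, ?_⟩
  rw [pow_one]
  exact RingHom.isIntegralElem_of_isIntegral_range (hint (X i) (by simp))

/-- If the coordinates are not all algebraic over `ℂ[f₁, …, fₘ]`, then over every nonempty basic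
open subset some fibre is infinite: on it, a coordinate belonging to a transcendence basis takes
infinitely many values. -/
theorem exists_infinite_fibre {n m : ℕ} {f : Fin m → MvPolynomial (Fin n) ℂ}
    (halg : ¬ Algebra.IsAlgebraic (comorphism f).range (MvPolynomial (Fin n) ℂ))
    {h : MvPolynomial (Fin m) ℂ} (hh : comorphism f h ≠ 0) :
    ∃ x₀, eval (polyMap f x₀) h ≠ 0 ∧ (polyMap f ⁻¹' {polyMap f x₀}).Infinite := by
  classical
  set S := (comorphism f).range with hS
  have hCS : ∀ c, C c ∈ S := fun c => ⟨C c, algHom_C (bind₁ f) c⟩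
  have hfS : ∀ j, f j ∈ S := fun j => ⟨X j, bind₁_X_right f j⟩
  have hadj : Algebra.adjoin S (Set.range (X : Fin n → MvPolynomial (Fin n) ℂ)) = ⊤ := by
    refine top_unique fun p _ => ?_
    induction p using MvPolynomial.induction_on with
    | C c => exact Subalgebra.algebraMap_mem _ (⟨C c, hCS c⟩ : S)
    | add p q hp hq => exact add_mem (hp trivial) (hq trivial)
    | mul_X p i hp => exact mul_mem (hp trivial) (Algebra.subset_adjoin ⟨i, rfl⟩)
  have : Algebra.IsAlgebraic (Algebra.adjoin S (Set.range (X : Fin n → MvPolynomial (Fin n) ℂ)))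
      (MvPolynomial (Fin n) ℂ) :=
    ⟨fun b => isAlgebraic_algebraMap
      (⟨b, hadj ▸ Algebra.mem_top⟩ : Algebra.adjoin S (Set.range X))⟩
  obtain ⟨T, hT, hbasis⟩ := exists_isTranscendenceBasis_subset (R := S)
    (Set.range (X : Fin n → MvPolynomial (Fin n) ℂ))
  obtain ⟨t₀⟩ : Nonempty T := by
    by_contra hcon
    exact halg (hbasis.isEmpty_iff_isAlgebraic.1 (not_nonempty_iff.1 hcon))
  obtain ⟨i₀, hi₀⟩ := hT t₀.2
  have := hbasis.isAlgebraic
  set A := Algebra.adjoin S (Set.range ((↑) : T → MvPolynomial (Fin n) ℂ)) with hA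
  obtain ⟨g, hg, hgint⟩ := Algebra.IsAlgebraic.exists_integral_multiples A
    (Finset.univ.image (X : Fin n → MvPolynomial (Fin n) ℂ))
  let e : MvPolynomial T S ≃ₐ[S] A := hbasis.1.aevalEquiv
  have hg' : e.symm g ≠ 0 := fun h0 => hg (by simpa using h0)
  obtain ⟨c, hc⟩ := MvPolynomial.ne_zero_iff.1 hg'
  have hc' : (((e.symm g).coeff c : S) : MvPolynomial (Fin n) ℂ) ≠ 0 := fun h0 => hc (Subtype.ext h0)
  obtain ⟨x₀, hx₀⟩ : ∃ x₀, eval x₀ ((((e.symm g).coeff c : S) : MvPolynomial (Fin n) ℂ) *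
      comorphism f h) ≠ 0 := by
    by_contra! hcon
    exact mul_ne_zero hc' hh (MvPolynomial.funext fun x => by rw [hcon, map_zero])
  rw [map_mul, eval_comorphism] at hx₀
  refine ⟨x₀, right_ne_zero_of_mul hx₀, fun hfin => ?_⟩
  let ev : S →+* ℂ := (eval x₀).comp S.subtype
  have hg'' : MvPolynomial.map ev (e.symm g) ≠ 0 := by
    refine MvPolynomial.ne_zero_iff.2 ⟨c, ?_⟩
    rw [coeff_map]
    exact left_ne_zero_of_mul hx₀
  -- A point of the base of the extension, away from `g`, with a new value of the coordinate `t₀`.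
  obtain ⟨τ, hτ⟩ : ∃ τ : T → ℂ, eval τ (MvPolynomial.map ev (e.symm g) *
      ∏ a ∈ hfin.toFinset, (X t₀ - C (a i₀))) ≠ 0 := by
    by_contra! hcon
    refine mul_ne_zero hg'' (Finset.prod_ne_zero_iff.2 fun a _ h0 => ?_)
      (MvPolynomial.funext fun x => by rw [hcon, map_zero])
    have := congrArg (eval fun _ => a i₀ + 1) h0
    simp at this
  rw [map_mul, map_prod] at hτ
  let ψ : A →+* ℂ := ((eval τ).comp (MvPolynomial.map ev)).comp (e.symm : A →+* MvPolynomial T S)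
  have hgψ : g ∉ RingHom.ker ψ := fun h0 => left_ne_zero_of_mul hτ h0
  have : (RingHom.ker ψ).IsPrime := RingHom.ker_isPrime ψ
  have hX : ∀ i, IsIntegral A (g • (X i : MvPolynomial (Fin n) ℂ)) := fun i =>
    hgint (X i) (by simp)
  have hint : IntegralAway (algebraMap A (MvPolynomial (Fin n) ℂ)) g := by
    refine integralAway_of_forall_X (fun c => ?_) fun i => ⟨1, ?_⟩
    · exact RingHom.isIntegralElem_map (algebraMap A (MvPolynomial (Fin n) ℂ))
        (x := algebraMap S A ⟨C c, hCS c⟩)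
    · rw [pow_one]
      exact hX i
  have hproper : (RingHom.ker ψ).map (algebraMap A (MvPolynomial (Fin n) ℂ)) ≠ ⊤ := by
    refine Ideal.map_ne_top_of_isIntegral_pow_smul Subtype.val_injective (fun b => ?_) _ hgψ
    obtain ⟨N, hN⟩ := hint b
    refine ⟨N, ?_⟩
    rw [Algebra.smul_def, map_pow]
    exact hN
  obtain ⟨N, hN, hle⟩ := Ideal.exists_le_maximal _ hproper
  obtain ⟨x, rfl⟩ := isMaximal_iff_eq_vanishingIdeal_singleton.1 hN
  have hval : ∀ (a : A), eval x (a : MvPolynomial (Fin n) ℂ) = ψ a := by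
    intro a
    have hψC : ψ (algebraMap S A ⟨C (ψ a), hCS _⟩) = ψ a := by
      have : e.symm (algebraMap S A ⟨C (ψ a), hCS _⟩) = C ⟨C (ψ a), hCS _⟩ := by
        rw [AlgEquiv.commutes]; rfl
      change eval τ (MvPolynomial.map ev (e.symm _)) = _
      rw [this, map_C, eval_C]
      exact eval_C _
    have hmem : a - algebraMap S A ⟨C (ψ a), hCS _⟩ ∈ RingHom.ker ψ := by
      rw [RingHom.mem_ker, map_sub, hψC, sub_self]
    have := hle (Ideal.mem_map_of_mem _ hmem) x rfl
    rw [map_sub, map_sub, sub_eq_zero] at this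
    exact this.trans (eval_C _)
  have hfx : polyMap f x = polyMap f x₀ := by
    funext j
    have := hval (algebraMap S A ⟨f j, hfS j⟩)
    refine this.trans ?_
    change eval τ (MvPolynomial.map ev (e.symm _)) = _
    rw [AlgEquiv.commutes]
    change eval τ (MvPolynomial.map ev (C _)) = _
    rw [map_C, eval_C]; rfl
  have hxi : x i₀ = τ t₀ := by
    have := hval (e (X t₀))
    have he : (e (X t₀) : MvPolynomial (Fin n) ℂ) = X i₀ := by
      rw [hi₀]; exact (hbasis.1.algebraMap_aevalEquiv _).trans (aeval_X _ _)
    rw [he, eval_X] at this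
    rw [this]
    change eval τ (MvPolynomial.map ev (e.symm (e (X t₀)))) = _
    rw [AlgEquiv.symm_apply_apply, map_X, eval_X]
  have h0 := Finset.prod_ne_zero_iff.1 (right_ne_zero_of_mul hτ) x
    (hfin.mem_toFinset.2 hfx)
  exact h0 (by simp [hxi])

theorem GenericallyFinite.exists_integralAway {n m : ℕ} {f : Fin m → MvPolynomial (Fin n) ℂ}
    (hf : GenericallyFinite f) :
    ∃ h : MvPolynomial (Fin m) ℂ, comorphism f h ≠ 0 ∧ IntegralAway (comorphism f) h := by
  refine exists_integralAway_of_isAlgebraic ?_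
  by_contra halg
  obtain ⟨O, hO, ⟨y, hy, hyO⟩, hfin⟩ := hf
  obtain ⟨h, hhy, hhO⟩ := exists_basicOpen_subset hO hyO
  obtain ⟨x, hx, hinf⟩ := exists_infinite_fibre halg
    (fun h0 => hhy (mem_imageClosure_iff.1 hy h h0))
  exact hinf (hfin _ ⟨polyMap_mem_imageClosure f x, hhO _ hx⟩)

/-- A generically finite polynomial map is proper at some point of its image. -/
theorem GenericallyFinite.exists_properAt {n m : ℕ} {f : Fin m → MvPolynomial (Fin n) ℂ}
    (hf : GenericallyFinite f) : ∃ o, ProperAt f (polyMap f o) := by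
  obtain ⟨h, h0, hh⟩ := hf.exists_integralAway
  obtain ⟨o, ho⟩ : ∃ o, eval o (comorphism f h) ≠ 0 := by
    by_contra! hcon
    exact h0 (MvPolynomial.funext fun x => by rw [hcon, map_zero])
  rw [eval_comorphism] at ho
  exact ⟨o, properAt_of_integralAway hh ho⟩

/-! ### Points and curves at infinity through valuation rings -/

/-- A coordinate which is not integral over a localization of `ℂ[f₁, …, fₘ]` at a prime. -/
theorem exists_X_not_isIntegralElem {n m : ℕ} {f : Fin m → MvPolynomial (Fin n) ℂ}
    {p : Ideal (MvPolynomial (Fin m) ℂ)} [hp : p.IsPrime]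
    (hnot : ∀ h ∉ p, ¬ IntegralAway (comorphism f) h) :
    ∃ i, ∀ s ∉ p, ¬ (comorphism f).IsIntegralElem (comorphism f s * X i) := by
  by_contra! hcon
  choose s hs hint using hcon
  refine hnot (∏ i, s i) (fun h => ?_) (integralAway_prod fun i => ⟨1, by simpa using hint i⟩)
  obtain ⟨i, -, hi⟩ := (Ideal.IsPrime.prod_mem_iff).1 h
  exact hs i hi

/-- An element not integral over a prime localization `Rₚ` is excluded by some valuation ring
containing `Rₚ`. -/
theorem exists_valuationSubring_of_not_isIntegralElem {R B Ω : Type*} [CommRing R] [CommRing B]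
    [Field Ω] (φ : R →+* B) (ψ : B →+* Ω) (hψ : Function.Injective ψ) (p : Ideal R) [p.IsPrime]
    (hker : ∀ h, φ h = 0 → h ∈ p) {b : B} (hb : ∀ s ∉ p, ¬ φ.IsIntegralElem (φ s * b)) :
    ∃ O : ValuationSubring Ω, (∀ h, ψ (φ h) ∈ O) ∧ (∀ h ∉ p, (ψ (φ h))⁻¹ ∈ O) ∧ ψ b ∉ O := by
  have hunit : ∀ s : p.primeCompl, IsUnit ((ψ.comp φ) s) := fun s =>
    IsUnit.mk0 _ fun h0 => s.2 (hker _ (hψ (by simpa using h0)))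
  let g : Localization.AtPrime p →+* Ω := IsLocalization.lift hunit
  have hg : ∀ h, g (algebraMap R _ h) = ψ (φ h) := fun h => IsLocalization.lift_eq hunit h
  obtain ⟨O, hO, hbO⟩ : ∃ O : ValuationSubring Ω, (g.range : Set Ω) ⊆ O.toSubring ∧ ψ b ∉ O := by
    by_contra! hcon
    have hmem : ψ b ∈ (integralClosure (Subring.closure (g.range : Set Ω)) Ω).toSubring := by
      rw [← iInf_valuationSubring_superset, Subring.mem_iInf]
      exact fun V => hcon V.1 V.2
    have hint : IsIntegral (Subring.closure (g.range : Set Ω)) (ψ b) := hmem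
    rw [Subring.closure_eq] at hint
    have hint' := RingHom.isIntegralElem_of_isIntegral_range hint
    let := g.toAlgebra
    let := (ψ.comp φ).toAlgebra
    have : IsScalarTower R (Localization.AtPrime p) Ω :=
      IsScalarTower.of_algebraMap_eq fun h => (hg h).symm
    obtain ⟨s, hs⟩ := IsIntegral.exists_multiple_integral_of_isLocalization p.primeCompl
      (Rₘ := Localization.AtPrime p) (ψ b) hint'
    refine hb s s.2 (RingHom.IsIntegralElem.of_map hψ ?_)
    have : ψ (φ s * b) = s • ψ b := map_mul ψ _ _
    rw [this]
    exact hs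
  refine ⟨O, fun h => hO ⟨_, hg h⟩, fun h hh => ?_, hbO⟩
  let s : p.primeCompl := ⟨h, hh⟩
  refine hO ⟨IsLocalization.mk' _ 1 s, eq_inv_of_mul_eq_one_left ?_⟩
  have hs : IsLocalization.mk' (Localization.AtPrime p) 1 s * algebraMap R _ h = 1 := by
    refine (IsLocalization.mk'_spec _ _ s).trans (map_one _)
  rw [← hg, ← map_mul, hs, map_one]

/-- If a generalized point `ψ` of `ℂⁿ` is not bounded with respect to a valuation ring, but its
image is, then the image specializes into the non-properness set. -/
theorem zeroLocus_ker_residue_subset {n m : ℕ} {f : Fin m → MvPolynomial (Fin n) ℂ} {Ω : Type*}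
    [Field Ω] (O : ValuationSubring Ω) (ψ : MvPolynomial (Fin n) ℂ →+* Ω)
    (ρ : MvPolynomial (Fin m) ℂ →+* O) (hρ : ∀ h, (ρ h : Ω) = ψ (comorphism f h)) {i : Fin n}
    (hi : ψ (X i) ∉ O) :
    zeroLocus ℂ (RingHom.ker ((IsLocalRing.residue O).comp ρ)) ⊆ nonProperSet f := by
  intro y hy
  have hyY : y ∈ imageClosure f := mem_imageClosure_iff.2 fun h h0 => hy h <| by
    have : ρ h = 0 := Subtype.ext (by rw [hρ, h0, map_zero]; rfl)
    rw [RingHom.mem_ker, RingHom.comp_apply, this, map_zero]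
  refine ⟨hyY, fun hprop => hi ?_⟩
  obtain ⟨h, hh, hint⟩ := hprop.exists_integralAway hyY
  obtain ⟨N, hN⟩ := hint (X i)
  have hunit : IsUnit (ρ h) := by
    by_contra hcon
    exact hh (hy h ((IsLocalRing.residue_eq_zero_iff _).2 hcon))
  have h1 := hN.map ψ
  have h2 : ψ.comp (comorphism f) = (algebraMap O Ω).comp ρ := RingHom.ext fun h => (hρ h).symm
  rw [h2] at h1
  obtain ⟨a, ha⟩ := (IsIntegrallyClosed.isIntegral_iff (R := O) (K := Ω)).1 h1.of_comp
  obtain ⟨u, hu⟩ := hunit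
  have h3 : ψ (X i) = ((↑(u⁻¹) : O) ^ N * a : O) := by
    have e1 : ((a : O) : Ω) = (ρ h : Ω) ^ N * ψ (X i) := by
      rw [hρ, ← map_pow, ← map_mul, ← map_pow]
      rw [map_pow]; exact ha
    have e2 : ((↑(u⁻¹) : O) : Ω) * (ρ h : Ω) = 1 := by
      rw [← hu]; exact congrArg Subtype.val u.inv_mul
    push_cast
    rw [e1, ← mul_assoc, ← mul_pow, e2, one_pow, one_mul]
  rw [h3]
  exact Subtype.prop _

/-- A polynomial curve over a valued algebraically closed field whose origin is integral can be
reparametrized linearly so that it is integral and has a nonconstant reduction. -/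
theorem exists_integral_reparametrization {Ω : Type*} [Field Ω] [IsAlgClosed Ω]
    (O : ValuationSubring Ω) {m : ℕ} (P : Fin m → Polynomial Ω) (h0 : ∀ j, (P j).coeff 0 ∈ O)
    (hne : ∃ j k, 0 < k ∧ (P j).coeff k ≠ 0) :
    ∃ l : Ω, l ≠ 0 ∧ ∃ Q : Fin m → Polynomial O,
      (∀ j, (Q j).map (algebraMap O Ω) = (P j).comp (Polynomial.C l * Polynomial.X)) ∧
      ∃ j k, 0 < k ∧ IsLocalRing.residue O ((Q j).coeff k) ≠ 0 := by
  classical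
  have hroot : ∀ x : Σ _ : Fin m, ℕ, ∃ u : Ω, 0 < x.2 → u ^ x.2 = (P x.1).coeff x.2 := fun x => by
    by_cases hx : 0 < x.2
    · obtain ⟨u, hu⟩ := IsAlgClosed.exists_pow_nat_eq ((P x.1).coeff x.2) hx
      exact ⟨u, fun _ => hu⟩
    · exact ⟨0, fun h => absurd h hx⟩
  choose u hu using hroot
  let s : Finset (Σ _ : Fin m, ℕ) := Finset.univ.sigma fun j => (P j).support.filter (0 < ·)
  have hs : ∀ j k, ⟨j, k⟩ ∈ s ↔ (P j).coeff k ≠ 0 ∧ 0 < k := fun j k => by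
    simp [s]
  obtain ⟨j₁, k₁, hk₁, hne₁⟩ := hne
  -- The dilation factor is the inverse of a `k`-th root of a coefficient of degree `k`, chosen
  -- with the largest valuation.
  obtain ⟨⟨j₀, k₀⟩, hmem, hmax⟩ := s.exists_max_image (fun x => O.valuation (u x))
    ⟨⟨j₁, k₁⟩, (hs _ _).2 ⟨hne₁, hk₁⟩⟩
  obtain ⟨hc₀, hk₀⟩ := (hs _ _).1 hmem
  have hu₀ : u ⟨j₀, k₀⟩ ≠ 0 := fun h => hc₀ (by
    rw [← hu ⟨j₀, k₀⟩ hk₀, h, zero_pow hk₀.ne'])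
  have hcoeff : ∀ j k, ((P j).comp (Polynomial.C (u ⟨j₀, k₀⟩)⁻¹ * Polynomial.X)).coeff k =
      (P j).coeff k * (u ⟨j₀, k₀⟩)⁻¹ ^ k := fun j k => Polynomial.comp_C_mul_X_coeff
  have hint : ∀ j k, (P j).coeff k * (u ⟨j₀, k₀⟩)⁻¹ ^ k ∈ O := by
    intro j k
    rcases Nat.eq_zero_or_pos k with rfl | hk
    · simpa using h0 j
    by_cases hc : (P j).coeff k = 0
    · rw [hc, zero_mul]; exact O.zero_mem
    rw [← hu ⟨j, k⟩ hk, ← mul_pow]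
    refine pow_mem (S := O) ?_ k
    rw [← O.valuation_le_one_iff, map_mul, map_inv₀]
    have hv : O.valuation (u ⟨j₀, k₀⟩) ≠ 0 := (Valuation.ne_zero_iff _).2 hu₀
    have := hmax ⟨j, k⟩ ((hs _ _).2 ⟨hc, hk⟩)
    calc _ ≤ O.valuation (u ⟨j₀, k₀⟩) * (O.valuation (u ⟨j₀, k₀⟩))⁻¹ := by gcongr
      _ = 1 := mul_inv_cancel₀ hv
  have hQ : ∀ j, ∃ Q : Polynomial O, Q.map (algebraMap O Ω) =
      (P j).comp (Polynomial.C (u ⟨j₀, k₀⟩)⁻¹ * Polynomial.X) := fun j => by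
    refine (Polynomial.mem_lifts _).1 ((Polynomial.lifts_iff_coeff_lifts _).2 fun k => ?_)
    rw [hcoeff]
    exact ⟨⟨_, hint j k⟩, rfl⟩
  choose Q hQ using hQ
  refine ⟨_, inv_ne_zero hu₀, Q, hQ, j₀, k₀, hk₀, fun hres => ?_⟩
  have h1 : (Q j₀).coeff k₀ = 1 := by
    refine Subtype.ext ?_
    have := congrArg (Polynomial.coeff · k₀) (hQ j₀)
    simp only [Polynomial.coeff_map] at this
    refine this.trans ?_
    rw [hcoeff, ← hu ⟨j₀, k₀⟩ hk₀, ← mul_pow, mul_inv_cancel₀ hu₀, one_pow]; rfl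
  rw [h1, map_one] at hres
  exact one_ne_zero hres

/-! ### Descending and specializing curves -/

/-- A `ℂ`-algebra of finite type that is a nonzero ring has a `ℂ`-valued point. -/
theorem nonempty_algHom_complex (S : Type*) [CommRing S] [Nontrivial S] [Algebra ℂ S]
    [Algebra.FiniteType ℂ S] : Nonempty (S →ₐ[ℂ] ℂ) := by
  obtain ⟨M, hM⟩ := Ideal.exists_maximal S
  let := Ideal.Quotient.field M
  have : Module.Finite ℂ (S ⧸ M) := finite_of_finite_type_of_isJacobsonRing ℂ (S ⧸ M)
  exact ⟨(IsAlgClosed.lift (R := ℂ) (S := S ⧸ M) (M := ℂ)).comp (Ideal.Quotient.mkₐ ℂ M)⟩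

theorem map_aeval_polynomial {A B σ : Type*} [CommRing A] [CommRing B] [Algebra ℂ A] [Algebra ℂ B]
    (g : A →ₐ[ℂ] B) (Q : σ → Polynomial A) (h : MvPolynomial σ ℂ) :
    (aeval Q h).map (g : A →+* B) = aeval (fun j => (Q j).map (g : A →+* B)) h := by
  change Polynomial.mapAlgHom g (aeval Q h) = _
  rw [← AlgHom.comp_apply, comp_aeval]
  rfl

theorem eval_aeval_polynomial {A σ : Type*} [CommRing A] [Algebra ℂ A]
    (Q : σ → Polynomial A) (a : A) (h : MvPolynomial σ ℂ) :
    (aeval Q h).eval a = aeval (fun j => (Q j).eval a) h := by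
  change (Polynomial.aeval a).restrictScalars ℂ (aeval Q h) = _
  rw [← AlgHom.comp_apply, comp_aeval]
  rfl

/-- By the Nullstellensatz, a curve with a complex origin over an extension of `ℂ` can be replaced
by one over `ℂ` with the same origin, subject to the same equations. -/
theorem exists_parametricCurve_of_extension {m e : ℕ} {κ : Type*} [Field κ] [Algebra ℂ κ]
    {I : Ideal (MvPolynomial (Fin m) ℂ)} {z : Fin m → ℂ} {Q : Fin m → Polynomial κ}
    (hdeg : ∀ j, (Q j).natDegree ≤ e) (hne : ∃ j k, 0 < k ∧ (Q j).coeff k ≠ 0)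
    (h0 : ∀ j, (Q j).coeff 0 = algebraMap ℂ κ (z j)) (hI : ∀ h ∈ I, aeval Q h = 0) :
    ∃ Γ, IsParametricCurve e Γ ∧ z ∈ Γ ∧ Γ ⊆ zeroLocus ℂ I := by
  classical
  obtain ⟨j₀, k₀, hk₀, hne⟩ := hne
  let t : Finset κ := insert ((Q j₀).coeff k₀)⁻¹
    (Finset.univ.image fun x : Fin m × Fin (e + 1) => (Q x.1).coeff x.2)
  let S := Algebra.adjoin ℂ (t : Set κ)
  have hcoeff : ∀ j k, (Q j).coeff k ∈ S := fun j k => by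
    by_cases hk : k < e + 1
    · refine Algebra.subset_adjoin (Finset.mem_coe.2 (Finset.mem_insert_of_mem ?_))
      exact Finset.mem_image.2 ⟨(j, ⟨k, hk⟩), Finset.mem_univ _, rfl⟩
    · rw [Polynomial.coeff_eq_zero_of_natDegree_lt (by have := hdeg j; omega)]
      exact S.zero_mem
  have hinv : ((Q j₀).coeff k₀)⁻¹ ∈ S :=
    Algebra.subset_adjoin (Finset.mem_coe.2 (Finset.mem_insert_self _ _))
  have : Algebra.FiniteType ℂ S := S.fg_iff_finiteType.1 (Subalgebra.fg_adjoin_finset t)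
  obtain ⟨σ⟩ := nonempty_algHom_complex S
  have hQ : ∀ j, ∃ q : Polynomial S, q.map (S.val : S →+* κ) = Q j := fun j =>
    (Polynomial.mem_lifts _).1 ((Polynomial.lifts_iff_coeff_lifts _).2 fun k =>
      ⟨⟨_, hcoeff j k⟩, rfl⟩)
  choose q hq using hQ
  have hinj : Function.Injective (S.val : S →+* κ) := Subtype.val_injective
  have hqdeg : ∀ j, (q j).natDegree ≤ e := fun j => by
    rw [← Polynomial.natDegree_map_eq_of_injective hinj, hq]
    exact hdeg j
  have hqc : ∀ j k, ((q j).coeff k : κ) = (Q j).coeff k := fun j k => by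
    rw [← hq j, Polynomial.coeff_map]; rfl
  let p : Fin m → Polynomial ℂ := fun j => (q j).map (σ : S →+* ℂ)
  have hp0 : ∀ j, (p j).coeff 0 = z j := fun j => by
    have : (q j).coeff 0 = algebraMap ℂ S (z j) := Subtype.ext ((hqc j 0).trans (h0 j))
    rw [Polynomial.coeff_map, this]
    exact σ.commutes (z j)
  have hpI : ∀ h ∈ I, aeval p h = 0 := fun h hh => by
    have h1 : aeval q h = 0 := Polynomial.map_injective _ hinj <| by
      rw [map_aeval_polynomial S.val q h, funext hq, hI h hh, Polynomial.map_zero]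
    rw [← map_aeval_polynomial σ q h, h1, Polynomial.map_zero]
  refine ⟨_, ⟨p, fun j => Polynomial.natDegree_map_le.trans (hqdeg j), ⟨j₀, ?_⟩, rfl⟩, ⟨0, ?_⟩, ?_⟩
  · refine hk₀.trans_le (Polynomial.le_natDegree_of_ne_zero ?_)
    rw [Polynomial.coeff_map]
    have hu : (⟨_, hinv⟩ : S) * (q j₀).coeff k₀ = 1 :=
      Subtype.ext (by
        change ((Q j₀).coeff k₀)⁻¹ * ((q j₀).coeff k₀ : κ) = 1
        rw [hqc, inv_mul_cancel₀ hne])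
    have := congrArg (σ : S →+* ℂ) hu
    rw [map_mul, map_one] at this
    exact right_ne_zero_of_mul_eq_one this
  · funext j
    change (p j).eval 0 = z j
    rw [← Polynomial.coeff_zero_eq_eval_zero, hp0]
  · rintro _ ⟨a, rfl⟩ h hh
    have := eval_aeval_polynomial p a h
    rw [hpI h hh, Polynomial.eval_zero] at this
    exact this.symm

/-- The algebra structure on a valuation ring containing the constants. -/
noncomputable abbrev ValuationSubring.complexAlgebra {Ω : Type*} [Field Ω] [Algebra ℂ Ω]
    (O : ValuationSubring Ω) (hO : ∀ c : ℂ, algebraMap ℂ Ω c ∈ O) : Algebra ℂ O :=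
  ((algebraMap ℂ Ω).codRestrict O.toSubring hO).toAlgebra

theorem ValuationSubring.isScalarTower_complexAlgebra {Ω : Type*} [Field Ω] [Algebra ℂ Ω]
    (O : ValuationSubring Ω) (hO : ∀ c : ℂ, algebraMap ℂ Ω c ∈ O) :
    @IsScalarTower ℂ O Ω (O.complexAlgebra hO).toSMul _ _ :=
  let := O.complexAlgebra hO
  IsScalarTower.of_algebraMap_eq fun _ => rfl

theorem comp_aeval_polynomial {A σ : Type*} [CommRing A] [Algebra ℂ A]
    (Q : σ → Polynomial A) (a : A) (h : MvPolynomial σ ℂ) :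
    (aeval Q h).comp (Polynomial.C a * Polynomial.X) =
      aeval (fun j => (Q j).comp (Polynomial.C a * Polynomial.X)) h := by
  change (Polynomial.aeval (Polynomial.C a * Polynomial.X)).restrictScalars ℂ (aeval Q h) = _
  rw [← AlgHom.comp_apply, comp_aeval]
  rfl

theorem natDegree_le_of_map_eq_comp {Ω : Type*} [Field Ω] {O : ValuationSubring Ω}
    {Q : Polynomial O} {P : Polynomial Ω} {l : Ω}
    (hQ : Q.map (algebraMap O Ω) = P.comp (Polynomial.C l * Polynomial.X)) :
    Q.natDegree ≤ P.natDegree := by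
  rw [← Polynomial.natDegree_map_eq_of_injective (FaithfulSMul.algebraMap_injective O Ω), hQ]
  refine Polynomial.natDegree_comp_le.trans ?_
  exact (Nat.mul_le_mul_left _ ((Polynomial.natDegree_C_mul_le _ _).trans
    Polynomial.natDegree_X_le)).trans_eq (mul_one _)

/-- A curve through the generic point of the variety of `I` specializes to a curve through any
given point of it. -/
theorem exists_parametricCurve_of_generic {m e : ℕ} {κ : Type*} [Field κ] [Algebra ℂ κ]
    {I : Ideal (MvPolynomial (Fin m) ℂ)} {Q : Fin m → Polynomial κ}
    (hdeg : ∀ j, (Q j).natDegree ≤ e) (hne : ∃ j k, 0 < k ∧ (Q j).coeff k ≠ 0)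
    (hgen : ∀ h, aeval (fun j => (Q j).coeff 0) h = 0 → h ∈ I) (hI : ∀ h ∈ I, aeval Q h = 0)
    {z : Fin m → ℂ} (hz : z ∈ zeroLocus ℂ I) :
    ∃ Γ, IsParametricCurve e Γ ∧ z ∈ Γ ∧ Γ ⊆ zeroLocus ℂ I := by
  let Ω := AlgebraicClosure κ
  let α : MvPolynomial (Fin m) ℂ →ₐ[ℂ] Ω :=
    (IsScalarTower.toAlgHom ℂ κ Ω).comp (aeval fun j => (Q j).coeff 0)
  have hα : ∀ h, α h = 0 → h ∈ I := fun h hh =>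
    hgen h ((map_eq_zero_iff _ (algebraMap κ Ω).injective).1 hh)
  -- The valuation ring is centred at `z`.
  let J : Ideal (α : MvPolynomial (Fin m) ℂ →+* Ω).range :=
    (vanishingIdeal ℂ {z}).map (α : MvPolynomial (Fin m) ℂ →+* Ω).rangeRestrict
  have hJ : J ≠ ⊤ := by
    intro htop
    have h1 : (1 : (α : MvPolynomial (Fin m) ℂ →+* Ω).range) ∈ J := htop ▸ Submodule.mem_top
    obtain ⟨h, hh, hh1⟩ := (Ideal.mem_map_iff_of_surjective _
      (α : MvPolynomial (Fin m) ℂ →+* Ω).rangeRestrict_surjective).1 h1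
    have h2 : α (h - 1) = 0 := by
      rw [map_sub, map_one, sub_eq_zero]
      exact congrArg Subtype.val hh1
    have h3 : eval z (h - 1) = 0 := hz _ (hα _ h2)
    have h4 : eval z h = 0 := hh z rfl
    rw [map_sub, h4, map_one] at h3
    norm_num at h3
  obtain ⟨O, hO, hJO⟩ := Ideal.image_subset_nonunits_valuationSubring J hJ
  have hαO : ∀ h, α h ∈ O := fun h => hO ⟨h, rfl⟩
  have hαz : ∀ h, eval z h = 0 → α h ∈ O.nonunits := fun h hh =>
    hJO ⟨_, Ideal.mem_map_of_mem _ (fun y hy => by rw [hy]; exact hh), rfl⟩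
  have hconst : ∀ c : ℂ, algebraMap ℂ Ω c ∈ O := fun c => by
    have := hαO (C c)
    rwa [← algebraMap_eq, AlgHom.commutes] at this
  let := O.complexAlgebra hconst
  have := O.isScalarTower_complexAlgebra hconst
  let P : Fin m → Polynomial Ω := fun j => (Q j).map (algebraMap κ Ω)
  have hP0 : ∀ j, (P j).coeff 0 = α (X j) := fun j => by
    change _ = algebraMap κ Ω (aeval _ (X j))
    rw [Polynomial.coeff_map, aeval_X]
  obtain ⟨l, -, Q', hQ', hne'⟩ := exists_integral_reparametrization O P
    (fun j => by rw [hP0]; exact hαO _) (by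
      obtain ⟨j, k, hk, h⟩ := hne
      refine ⟨j, k, hk, ?_⟩
      rw [Polynomial.coeff_map]
      exact (map_ne_zero _).2 h)
  let R : Fin m → Polynomial (IsLocalRing.ResidueField O) := fun j => (Q' j).map
    (IsScalarTower.toAlgHom ℂ O (IsLocalRing.ResidueField O) : O →+* IsLocalRing.ResidueField O)
  refine exists_parametricCurve_of_extension (Q := R) (fun j => ?_) ?_ (fun j => ?_)
    fun h hh => ?_
  · refine Polynomial.natDegree_map_le.trans ((natDegree_le_of_map_eq_comp (hQ' j)).trans ?_)
    exact Polynomial.natDegree_map_le.trans (hdeg j)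
  · obtain ⟨j, k, hk, h⟩ := hne'
    refine ⟨j, k, hk, ?_⟩
    rw [Polynomial.coeff_map]
    exact h
  · have h1 : (((Q' j).coeff 0 : O) : Ω) = α (X j) := by
      have := congrArg (Polynomial.coeff · 0) (hQ' j)
      simp only [Polynomial.coeff_map, Polynomial.comp_C_mul_X_coeff, pow_zero, mul_one, hP0] at this
      exact this
    have h2 : (Q' j).coeff 0 - algebraMap ℂ O (z j) ∈ IsLocalRing.maximalIdeal O := by
      rw [← ValuationSubring.coe_mem_nonunits_iff]
      have : (((Q' j).coeff 0 - algebraMap ℂ O (z j) : O) : Ω) = α (X j - C (z j)) := by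
        rw [map_sub, ← algebraMap_eq, AlgHom.commutes, ← h1]; rfl
      rw [this]
      exact hαz _ (by simp)
    have h3 := (IsLocalRing.residue_eq_zero_iff _).2 h2
    rw [map_sub, sub_eq_zero] at h3
    rw [Polynomial.coeff_map]
    exact h3
  · have h1 : aeval Q' h = 0 := by
      refine Polynomial.map_injective _ (FaithfulSMul.algebraMap_injective O Ω) ?_
      have e1 := map_aeval_polynomial (IsScalarTower.toAlgHom ℂ O Ω) Q' h
      have e2 := map_aeval_polynomial (IsScalarTower.toAlgHom ℂ κ Ω) Q h
      rw [hI h hh, Polynomial.map_zero] at e2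
      have e3 := comp_aeval_polynomial P l h
      have e4 : aeval P h = 0 := e2.symm
      rw [e4, Polynomial.zero_comp] at e3
      rw [Polynomial.map_zero, e3]
      refine e1.trans ?_
      congr 2
      funext j
      exact hQ' j
    rw [← map_aeval_polynomial (IsScalarTower.toAlgHom ℂ O _) Q' h, h1, Polynomial.map_zero]

/-! ### Lines through a fixed point -/

/-- The line `t ↦ o + (1 + t) (ψ x - o)` joining the complex point `o` (reached at `t = -1`) to the
generalized point `ψ` of `ℂⁿ` (reached at `t = 0`), as a homomorphism on polynomials. -/
noncomputable def lineHom {n : ℕ} {Ω : Type*} [Field Ω] [Algebra ℂ Ω] (o : Fin n → ℂ)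
    (ψ : MvPolynomial (Fin n) ℂ →ₐ[ℂ] Ω) : MvPolynomial (Fin n) ℂ →ₐ[ℂ] Polynomial Ω :=
  aeval fun i => Polynomial.C (algebraMap ℂ Ω (o i)) +
    (1 + Polynomial.X) * Polynomial.C (ψ (X i) - algebraMap ℂ Ω (o i))

section

variable {n : ℕ} {Ω : Type*} [Field Ω] [Algebra ℂ Ω] (o : Fin n → ℂ)
  (ψ : MvPolynomial (Fin n) ℂ →ₐ[ℂ] Ω)

theorem eval_lineHom (s : Ω) (p : MvPolynomial (Fin n) ℂ) :
    (lineHom o ψ p).eval s =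
      aeval (fun i => algebraMap ℂ Ω (o i) + (1 + s) * (ψ (X i) - algebraMap ℂ Ω (o i))) p := by
  rw [lineHom, eval_aeval_polynomial]
  simp

theorem eval_zero_lineHom (p : MvPolynomial (Fin n) ℂ) : (lineHom o ψ p).eval 0 = ψ p := by
  rw [eval_lineHom]
  simp only [add_zero, one_mul, add_sub_cancel]
  exact (aeval_unique ψ ▸ rfl)

theorem eval_neg_one_lineHom (p : MvPolynomial (Fin n) ℂ) :
    (lineHom o ψ p).eval (-1) = algebraMap ℂ Ω (eval o p) := by
  rw [eval_lineHom]
  simp only [add_neg_cancel, zero_mul, add_zero]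
  rw [← aeval_eq_eval]
  exact aeval_algebraMap_apply Ω o p

theorem natDegree_lineHom_le (p : MvPolynomial (Fin n) ℂ) :
    (lineHom o ψ p).natDegree ≤ p.totalDegree := by
  rw [lineHom, ← aeval_map_algebraMap Ω]
  refine (aeval_natDegree_le _ (Finset.sup_mono (support_map_subset _ _)) _ (n := 1) fun i => ?_).trans_eq
    (mul_one _)
  refine Polynomial.natDegree_add_le_of_degree_le (by simp) ?_
  refine (Polynomial.natDegree_mul_C_le _ _).trans ?_
  exact Polynomial.natDegree_add_le_of_degree_le (by simp) Polynomial.natDegree_X_le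

end

section

variable {n m : ℕ} {f : Fin m → MvPolynomial (Fin n) ℂ} {Ω : Type*} [Field Ω] [Algebra ℂ Ω]
  {O : ValuationSubring Ω} [Algebra ℂ O] [IsScalarTower ℂ O Ω] {o : Fin n → ℂ}
  {ψ : MvPolynomial (Fin n) ℂ →ₐ[ℂ] Ω}

/-- An unbounded point of the line with bounded image specializes into the non-properness set. -/
theorem zeroLocus_ker_subset_of_line {s : Ω} {i : Fin n}
    (hs : algebraMap ℂ Ω (o i) + (1 + s) * (ψ (X i) - algebraMap ℂ Ω (o i)) ∉ O)
    (v : Fin m → O) (hv : ∀ j, (v j : Ω) = (lineHom o ψ (f j)).eval s) :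
    zeroLocus ℂ (RingHom.ker (aeval fun j => IsLocalRing.residue O (v j) :
      MvPolynomial (Fin m) ℂ →ₐ[ℂ] IsLocalRing.ResidueField O)) ⊆ nonProperSet f := by
  have h1 : ((IsLocalRing.residue O).comp (aeval v : MvPolynomial (Fin m) ℂ →ₐ[ℂ] O).toRingHom) =
      (aeval fun j => IsLocalRing.residue O (v j) :
        MvPolynomial (Fin m) ℂ →ₐ[ℂ] IsLocalRing.ResidueField O).toRingHom := by
    have := comp_aeval v (IsScalarTower.toAlgHom ℂ O (IsLocalRing.ResidueField O))
    exact congrArg AlgHom.toRingHom this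
  have h2 := zeroLocus_ker_residue_subset (f := f) O
    ((Polynomial.evalRingHom s).comp (lineHom o ψ).toRingHom)
    (aeval v : MvPolynomial (Fin m) ℂ →ₐ[ℂ] O).toRingHom (fun h => ?_) (i := i) ?_
  · rw [h1] at h2
    exact h2
  · have e1 : (IsScalarTower.toAlgHom ℂ O Ω).comp (aeval v) =
        (((Polynomial.aeval s).restrictScalars ℂ).comp (lineHom o ψ)).comp (bind₁ f) := by
      refine MvPolynomial.algHom_ext fun j => ?_
      rw [AlgHom.comp_apply, AlgHom.comp_apply, aeval_X, bind₁_X_right]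
      exact hv j
    exact congrArg (fun g : MvPolynomial (Fin m) ℂ →ₐ[ℂ] Ω => g h) e1
  · have : (lineHom o ψ (X i)).eval s ∉ O := by
      rw [eval_lineHom, aeval_X]
      exact hs
    exact this

/-- Along a line that joins a point over which `f` is proper to a point at infinity, `f` is not
bounded: otherwise a point of the line which tends to infinity more slowly would have an image
tending to `f o`. -/
theorem line_not_integral [IsAlgClosed Ω] (ho : ProperAt f (polyMap f o)) {i : Fin n}
    (hi : ψ (X i) ∉ O) (Q : Fin m → Polynomial O)
    (hQ : ∀ j, (Q j).map (algebraMap O Ω) = lineHom o ψ (f j)) : False := by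
  set c := ψ (X i) - algebraMap ℂ Ω (o i) with hc
  have hoO : ∀ a : ℂ, algebraMap ℂ Ω a ∈ O := fun a => by
    rw [IsScalarTower.algebraMap_apply ℂ O Ω]
    exact Subtype.prop _
  have hcO : c ∉ O := fun h => hi (by
    have := add_mem h (hoO (o i))
    rwa [hc, sub_add_cancel] at this)
  have hc0 : c ≠ 0 := fun h => hcO (h ▸ O.zero_mem)
  -- A point `s` of the line close to `-1`, at which the coordinate still tends to infinity.
  obtain ⟨u, hu⟩ := IsAlgClosed.exists_pow_nat_eq c⁻¹ (n := 2) two_pos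
  have hu0 : u ≠ 0 := by
    rintro rfl
    exact inv_ne_zero hc0 (by rw [← hu]; simp)
  have huc : u * c = u⁻¹ := by
    rw [← inv_inv c, ← hu]; field_simp
  have huinv : u⁻¹ ∉ O := fun h => hcO (by
    have := mul_mem h h
    rwa [← mul_inv, ← sq, hu, inv_inv] at this)
  have hu' : u ∈ O.nonunits := (ValuationSubring.mem_nonunits_iff_or _).2 (Or.inr huinv)
  obtain ⟨huO, humax⟩ := ValuationSubring.mem_nonunits_iff_exists_mem_maximalIdeal.1 hu'
  have hres : IsLocalRing.residue O (⟨u, huO⟩ - 1) = -1 := by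
    rw [map_sub, (IsLocalRing.residue_eq_zero_iff _).2 humax, map_one, zero_sub]
  have key := zeroLocus_ker_subset_of_line (f := f) (o := o) (ψ := ψ) (s := u - 1) (i := i)
    (O := O) (fun h => huinv ?_) (fun j => (Q j).eval (⟨u, huO⟩ - 1)) (fun j => ?_)
  · refine (key (fun h hh => ?_ : polyMap f o ∈ _)).2 ho
    have hval : ∀ j, IsLocalRing.residue O ((Q j).eval (⟨u, huO⟩ - 1)) =
        algebraMap ℂ (IsLocalRing.ResidueField O) (polyMap f o j) := fun j => by
      have h1 : (Q j).eval (-1) = algebraMap ℂ O (polyMap f o j) := by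
        refine FaithfulSMul.algebraMap_injective O Ω ?_
        rw [← IsScalarTower.algebraMap_apply, ← Polynomial.eval_map_apply, hQ, map_neg, map_one,
          eval_neg_one_lineHom]
        rfl
      rw [IsScalarTower.algebraMap_apply ℂ O (IsLocalRing.ResidueField O), ← h1]
      change IsLocalRing.residue O _ = IsLocalRing.residue O _
      rw [← Polynomial.eval_map_apply, ← Polynomial.eval_map_apply, hres, map_neg, map_one]
    rw [RingHom.mem_ker, funext hval] at hh
    exact (map_eq_zero_iff _ (algebraMap ℂ (IsLocalRing.ResidueField O)).injective).1
      ((aeval_algebraMap_apply _ _ _).symm.trans hh)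
  · have h1 : (1 + (u - 1)) * (ψ (X i) - algebraMap ℂ Ω (o i)) = u⁻¹ := by
      rw [← hc, ← huc]; ring
    rw [h1] at h
    have := sub_mem h (hoO (o i))
    rwa [add_sub_cancel_left] at this
  · rw [← hQ]
    have : u - 1 = algebraMap O Ω (⟨u, huO⟩ - 1) := rfl
    rw [this, Polynomial.eval_map_apply]
    rfl

/-- The reparametrized image of the line is an integral curve whose reduction is not constant. The
reduction has degree at most `d - 1`: the value `f o` is taken at the infinitely large parameter
`-1 / l`, which a nonzero coefficient of degree `d` does not allow. -/
theorem exists_reduced_line [IsAlgClosed Ω] (ho : ProperAt f (polyMap f o)) {i : Fin n}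
    (hi : ψ (X i) ∉ O) (hf : ∀ j, ψ (f j) ∈ O) {d : ℕ} (hd : ∀ j, (f j).totalDegree ≤ d) :
    ∃ l ∈ O.nonunits, ∃ Q : Fin m → Polynomial O,
      (∀ j, (Q j).map (algebraMap O Ω) =
        (lineHom o ψ (f j)).comp (Polynomial.C l * Polynomial.X)) ∧
      (∀ j, ((Q j).map (IsLocalRing.residue O)).natDegree ≤ d - 1) ∧
      ∃ j k, 0 < k ∧ ((Q j).map (IsLocalRing.residue O)).coeff k ≠ 0 := by
  have h0 : ∀ j, (lineHom o ψ (f j)).coeff 0 ∈ O := fun j => by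
    rw [Polynomial.coeff_zero_eq_eval_zero, eval_zero_lineHom]
    exact hf j
  have hcontra : ¬ ∀ j k, (lineHom o ψ (f j)).coeff k ∈ O := fun h => by
    have hQ : ∀ j, ∃ Q : Polynomial O, Q.map (algebraMap O Ω) = lineHom o ψ (f j) := fun j =>
      (Polynomial.mem_lifts _).1 ((Polynomial.lifts_iff_coeff_lifts _).2 fun k =>
        ⟨⟨_, h j k⟩, rfl⟩)
    choose Q hQ using hQ
    exact line_not_integral ho hi Q hQ
  obtain ⟨l, hl0, Q, hQ, hne⟩ := exists_integral_reparametrization O (fun j => lineHom o ψ (f j)) h0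
    (by
      by_contra! hcon
      refine hcontra fun j k => ?_
      rcases Nat.eq_zero_or_pos k with rfl | hk
      · exact h0 j
      · rw [hcon j k hk]
        exact O.zero_mem)
  have hcoeff : ∀ j k, (((Q j).coeff k : O) : Ω) = (lineHom o ψ (f j)).coeff k * l ^ k :=
    fun j k => by
      have := congrArg (Polynomial.coeff · k) (hQ j)
      simp only [Polynomial.coeff_map, Polynomial.comp_C_mul_X_coeff] at this
      exact this
  have hlinv : l⁻¹ ∉ O := fun hinv => hcontra fun j k => by
    have := mul_mem ((Q j).coeff k).2 (pow_mem (S := O) hinv k)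
    rwa [hcoeff, mul_assoc, ← mul_pow, mul_inv_cancel₀ hl0, one_pow, mul_one] at this
  have hl : l ∈ O.nonunits := (ValuationSubring.mem_nonunits_iff_or _).2 (Or.inr hlinv)
  obtain ⟨hlO, hlmax⟩ := ValuationSubring.mem_nonunits_iff_exists_mem_maximalIdeal.1 hl
  have hdeg : ∀ j, (Q j).natDegree ≤ d := fun j =>
    (natDegree_le_of_map_eq_comp (hQ j)).trans ((natDegree_lineHom_le o ψ _).trans (hd j))
  refine ⟨l, hl, Q, hQ, fun j => ?_, ?_⟩
  · refine Polynomial.natDegree_le_iff_coeff_eq_zero.2 fun k hk => ?_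
    rw [Polynomial.coeff_map]
    rcases lt_or_ge d k with hdk | hdk
    · rw [Polynomial.coeff_eq_zero_of_natDegree_lt ((hdeg j).trans_lt hdk), map_zero]
    obtain rfl : k = d := by omega
    have hd0 : k ≠ 0 := by omega
    -- Multiply the expansion of the value at `-1 / l` by `l ^ d`.
    have h1 : ∑ r ∈ Finset.range (k + 1), (Q j).coeff r * ((-1) ^ r * (⟨l, hlO⟩ : O) ^ (k - r)) =
        (⟨l, hlO⟩ : O) ^ k * algebraMap ℂ O (eval o (f j)) := by
      refine FaithfulSMul.algebraMap_injective O Ω ?_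
      have hE := eval_neg_one_lineHom o ψ (f j)
      rw [Polynomial.eval_eq_sum_range' (Nat.lt_succ_of_le
        ((natDegree_lineHom_le o ψ (f j)).trans (hd j)))] at hE
      rw [map_mul, ← IsScalarTower.algebraMap_apply, ← hE, map_sum, map_pow, Finset.mul_sum]
      refine Finset.sum_congr rfl fun r hr => ?_
      have hr' : r ≤ k := by have := Finset.mem_range.1 hr; omega
      have e1 : algebraMap O Ω ⟨l, hlO⟩ = l := rfl
      have e2 : algebraMap O Ω ((Q j).coeff r) = _ := hcoeff j r
      rw [map_mul, map_mul, map_pow, map_pow, map_neg, map_one, e1, e2]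
      have e3 : l ^ k = l ^ r * l ^ (k - r) := by rw [← pow_add, Nat.add_sub_cancel' hr']
      rw [e3]; ring
    have h2 := congrArg (IsLocalRing.residue O) h1
    have hz := (IsLocalRing.residue_eq_zero_iff _).2 hlmax
    rw [map_mul, map_pow, hz, zero_pow hd0, zero_mul, Finset.sum_range_succ, map_add, map_sum,
      Finset.sum_eq_zero, zero_add] at h2
    · rw [map_mul, map_mul, map_pow, map_pow, map_neg, map_one, Nat.sub_self, pow_zero,
        mul_one, mul_eq_zero] at h2
      exact h2.resolve_right (pow_ne_zero _ (neg_ne_zero.2 one_ne_zero))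
    · intro r hr
      have hr' : k - r ≠ 0 := by have := Finset.mem_range.1 hr; omega
      rw [map_mul, map_mul, map_pow (IsLocalRing.residue O) ⟨l, hlO⟩, hz, zero_pow hr', mul_zero,
        mul_zero]
  · obtain ⟨j, k, hk, h⟩ := hne
    exact ⟨j, k, hk, by rw [Polynomial.coeff_map]; exact h⟩

end

/-! ### Curves in the irreducible components of the non-properness set -/

theorem isClosed_of_isIrredComponent {m : ℕ} {X Z : Set (Fin m → ℂ)}
    (hX : @IsClosed _ (zariski m) X) (hZ : IsIrredComponent X Z) : @IsClosed _ (zariski m) Z := by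
  let := zariski m
  have h := hZ.2 (y := closure Z) ⟨closure_minimal hZ.1.1 hX, hZ.1.2.closure⟩ subset_closure
  exact closure_subset_iff_isClosed.1 h

/-- A variety inside `X` which contains the component `Z` is `Z`, in terms of ideals. -/
theorem IsIrredComponent.vanishingIdeal_le {m : ℕ} {X Z : Set (Fin m → ℂ)}
    (hX : @IsClosed _ (zariski m) X) (hZ : IsIrredComponent X Z)
    {q : Ideal (MvPolynomial (Fin m) ℂ)} [q.IsPrime] (hqX : zeroLocus ℂ q ⊆ X)
    (hq : q ≤ vanishingIdeal ℂ Z) : vanishingIdeal ℂ Z ≤ q := by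
  have h1 : Z ⊆ zeroLocus ℂ q := by
    conv_lhs => rw [← zeroLocus_vanishingIdeal_of_isClosed (isClosed_of_isIrredComponent hX hZ)]
    exact zeroLocus_anti_mono hq
  have h2 := hZ.2 (y := zeroLocus ℂ q) ⟨hqX, isIrreducible_zeroLocus q⟩ h1
  rw [← IsPrime.vanishingIdeal_zeroLocus (K := ℂ) q]
  exact vanishingIdeal_anti_mono h2

/-- Through the generic point of a component of the non-properness set passes a curve of degree at
most `d - 1` inside that component. -/
theorem exists_generic_curve {n m d : ℕ} {f : Fin m → MvPolynomial (Fin n) ℂ}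
    (hf : GenericallyFinite f) (hd : ∀ j, (f j).totalDegree ≤ d) {Z : Set (Fin m → ℂ)}
    (hZ : IsIrredComponent (nonProperSet f) Z) :
    ∃ (κ : Type) (_ : Field κ) (_ : Algebra ℂ κ) (Q : Fin m → Polynomial κ),
      (∀ j, (Q j).natDegree ≤ d - 1) ∧ (∃ j k, 0 < k ∧ (Q j).coeff k ≠ 0) ∧
      (∀ h, aeval (fun j => (Q j).coeff 0) h = 0 → h ∈ vanishingIdeal ℂ Z) ∧
      ∀ h ∈ vanishingIdeal ℂ Z, aeval Q h = 0 := by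
  obtain ⟨o, ho⟩ := hf.exists_properAt
  have hS := isClosed_nonProperSet f
  have hp := isPrime_vanishingIdeal hZ.1.2
  set p := vanishingIdeal ℂ Z with hpdef
  have hker : ∀ h, comorphism f h = 0 → h ∈ p := fun h hh y hy =>
    mem_imageClosure_iff.1 (hZ.1.1 hy).1 h hh
  obtain ⟨i, hi⟩ := exists_X_not_isIntegralElem (f := f) (p := p) fun h hhp hh => by
    rw [hpdef, mem_vanishingIdeal_iff_eval] at hhp
    push Not at hhp
    obtain ⟨y, hy, hyh⟩ := hhp
    exact (hZ.1.1 hy).2 (properAt_of_integralAway hh hyh)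
  let Ω := AlgebraicClosure (FractionRing (MvPolynomial (Fin n) ℂ))
  let ψ : MvPolynomial (Fin n) ℂ →ₐ[ℂ] Ω :=
    (IsScalarTower.toAlgHom ℂ (FractionRing (MvPolynomial (Fin n) ℂ)) Ω).comp
      (IsScalarTower.toAlgHom ℂ _ (FractionRing (MvPolynomial (Fin n) ℂ)))
  have hψ : Function.Injective (ψ : MvPolynomial (Fin n) ℂ →+* Ω) :=
    (algebraMap (FractionRing (MvPolynomial (Fin n) ℂ)) Ω).injective.comp
      (IsFractionRing.injective _ _)
  obtain ⟨O, hO, hOinv, hiO⟩ := exists_valuationSubring_of_not_isIntegralElem (comorphism f)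
    (ψ : MvPolynomial (Fin n) ℂ →+* Ω) hψ p hker hi
  have hconst : ∀ c : ℂ, algebraMap ℂ Ω c ∈ O := fun c => by
    have := hO (C c)
    change ψ (bind₁ f (C c)) ∈ O at this
    rwa [algHom_C, AlgHom.commutes] at this
  let := O.complexAlgebra hconst
  have := O.isScalarTower_complexAlgebra hconst
  have hfO : ∀ j, ψ (f j) ∈ O := fun j => by
    have := hO (X j)
    change ψ (bind₁ f (X j)) ∈ O at this
    rwa [bind₁_X_right] at this
  obtain ⟨l, hl, Q, hQ, hdeg, hne⟩ := exists_reduced_line (O := O) ho hiO hfO hd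
  obtain ⟨hlO, hlmax⟩ := ValuationSubring.mem_nonunits_iff_exists_mem_maximalIdeal.1 hl
  let κ := IsLocalRing.ResidueField O
  let R : Fin m → Polynomial κ := fun j => (Q j).map (IsLocalRing.residue O)
  -- Each complex parameter gives a point at infinity of the line.
  have hpoint : ∀ τ : ℂ, zeroLocus ℂ (RingHom.ker (aeval fun j => (R j).eval (algebraMap ℂ κ τ) :
      MvPolynomial (Fin m) ℂ →ₐ[ℂ] κ)) ⊆ nonProperSet f := fun τ => by
    have hval : ∀ j, IsLocalRing.residue O ((Q j).eval (algebraMap ℂ O τ)) =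
        (R j).eval (algebraMap ℂ κ τ) := fun j => by
      rw [IsScalarTower.algebraMap_apply ℂ O κ]
      exact (Polynomial.eval_map_apply _ _).symm
    have key := zeroLocus_ker_subset_of_line (f := f) (o := o) (ψ := ψ)
      (s := l * algebraMap ℂ Ω τ) (i := i) (O := O) (fun h => hiO ?_)
      (fun j => (Q j).eval (algebraMap ℂ O τ)) (fun j => ?_)
    · rwa [funext hval] at key
    · -- The factor `1 + l τ` is a unit.
      have hunit : IsUnit (1 + ⟨l, hlO⟩ * algebraMap ℂ O τ : O) := by
        by_contra hcon
        have h1 := (IsLocalRing.residue_eq_zero_iff _).2 hcon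
        rw [map_add, map_mul, (IsLocalRing.residue_eq_zero_iff _).2 hlmax, map_one, zero_mul,
          add_zero] at h1
        exact one_ne_zero h1
      obtain ⟨w, hw⟩ := hunit
      have hw1 : (1 + l * algebraMap ℂ Ω τ) * ((↑w⁻¹ : O) : Ω) = 1 := by
        have := congrArg (algebraMap O Ω) w.mul_inv
        rw [hw, map_mul, map_one] at this
        exact this
      have h1 := sub_mem h (hconst (o i))
      rw [add_sub_cancel_left] at h1
      have h2 := add_mem (mul_mem h1 (↑w⁻¹ : O).2) (hconst (o i))
      rwa [mul_right_comm, hw1, one_mul, sub_add_cancel] at h2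
    · have h1 := congrArg (Polynomial.eval (algebraMap ℂ Ω τ)) (hQ j)
      rw [Polynomial.eval_comp, Polynomial.eval_mul, Polynomial.eval_C, Polynomial.eval_X,
        IsScalarTower.algebraMap_apply ℂ O Ω, Polynomial.eval_map_apply] at h1
      exact h1
  have hR0 : ∀ h, aeval (fun j => (R j).coeff 0) h = 0 → h ∈ p := fun h hh => by
    by_contra hhp
    have h1 : (fun j => (R j).coeff 0) =
        fun j => (IsScalarTower.toAlgHom ℂ O κ) (⟨ψ (f j), hfO j⟩ : O) := funext fun j => by
      have h2 : (Q j).coeff 0 = ⟨ψ (f j), hfO j⟩ := by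
        refine FaithfulSMul.algebraMap_injective O Ω ?_
        have := congrArg (Polynomial.coeff · 0) (hQ j)
        simp only [Polynomial.coeff_map, Polynomial.comp_C_mul_X_coeff, pow_zero, mul_one] at this
        rw [this, Polynomial.coeff_zero_eq_eval_zero, eval_zero_lineHom]
        rfl
      rw [Polynomial.coeff_map, h2]
      rfl
    rw [h1, ← comp_aeval_apply] at hh
    have h3 : algebraMap O Ω (aeval (fun j => (⟨ψ (f j), hfO j⟩ : O)) h) = ψ (comorphism f h) := by
      change (IsScalarTower.toAlgHom ℂ O Ω) _ = (ψ.comp (bind₁ f)) h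
      rw [← AlgHom.comp_apply]
      congr 1
      refine MvPolynomial.algHom_ext fun j => ?_
      rw [AlgHom.comp_apply, AlgHom.comp_apply, aeval_X, bind₁_X_right]
      rfl
    have h4 := ValuationSubring.coe_mem_nonunits_iff.2 ((IsLocalRing.residue_eq_zero_iff _).1 hh)
    rw [ValuationSubring.mem_nonunits_iff_or] at h4
    rcases h4 with h4 | h4
    · exact hhp (hker h (hψ ((h3.symm.trans h4).trans (map_zero _).symm)))
    · exact h4 (by
        have := hOinv h hhp
        have h5 : (↑(aeval (fun j => (⟨ψ (f j), hfO j⟩ : O)) h) : Ω) = ψ (comorphism f h) := h3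
        rw [h5]
        exact this)
  let q : Ideal (MvPolynomial (Fin m) ℂ) := RingHom.ker (aeval R : MvPolynomial (Fin m) ℂ →ₐ[ℂ] _)
  have : q.IsPrime := RingHom.ker_isPrime _
  have hqS : zeroLocus ℂ q ⊆ nonProperSet f := by
    intro y hy
    by_contra hyS
    obtain ⟨h, hh, hyh⟩ := exists_mem_vanishingIdeal_eval_ne_zero hS hyS
    refine hyh (hy h (RingHom.mem_ker.2 (Polynomial.eq_zero_of_infinite_isRoot _ ?_)))
    refine (Set.infinite_range_of_injective (algebraMap ℂ κ).injective).mono ?_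
    rintro _ ⟨τ, rfl⟩
    have : (RingHom.ker (aeval fun j => (R j).eval (algebraMap ℂ κ τ) :
      MvPolynomial (Fin m) ℂ →ₐ[ℂ] κ)).IsPrime := RingHom.ker_isPrime _
    have h1 := vanishingIdeal_anti_mono (k := ℂ) (hpoint τ) hh
    rw [IsPrime.vanishingIdeal_zeroLocus] at h1
    exact (eval_aeval_polynomial R _ h).trans h1
  refine ⟨κ, inferInstance, inferInstance, R, hdeg, hne, hR0, fun h hh => ?_⟩
  refine hZ.vanishingIdeal_le hS hqS (fun h hh => hR0 h ?_) hh
  have h1 := eval_aeval_polynomial R 0 h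
  rw [RingHom.mem_ker.1 hh, Polynomial.eval_zero] at h1
  simp only [Polynomial.coeff_zero_eq_eval_zero]
  exact h1.symm

theorem theorem2 (n m d : ℕ) (f : Fin m → MvPolynomial (Fin n) ℂ)
    (hf : GenericallyFinite f) (hd : polyMapDegree f = d) :
    nonProperSet f = ∅ ∨ UniruledDegreeAtMost (nonProperSet f) (d - 1) := by
  have hS := isClosed_nonProperSet f
  refine Or.inr ⟨hS, fun Z hZ z hz => ?_⟩
  have hd' : ∀ j, (f j).totalDegree ≤ d := fun j => by
    rw [← hd]
    exact Finset.le_sup (f := fun i => (f i).totalDegree) (Finset.mem_univ j)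
  obtain ⟨κ, _, _, Q, hdeg, hne, hgen, hQ⟩ := exists_generic_curve hf hd' hZ
  have hcl := zeroLocus_vanishingIdeal_of_isClosed (isClosed_of_isIrredComponent hS hZ)
  obtain ⟨Γ, hΓ, hzΓ, hΓZ⟩ := exists_parametricCurve_of_generic hdeg hne hgen hQ
    (z := z) (by rwa [hcl])
  exact ⟨Γ, hΓ, hzΓ, by rwa [hcl] at hΓZ⟩
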